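/- Let $0<d^-\le d^+<\infty$ and put $\theta=\min\{d^-,1\}$. There exists a positive constant $c=c(d^+,d^-)$, depending only on $d^+$ and $d^-$, such that the following holds. Let $(d_k)_{k\ge 1}$ be any sequence of real numbers with $d^-\le d_k\le d^+$ for all $k\ge 1$, and let $(p_j)_{j\ge 0}$ be the Taylor coefficients at $0$ of $$p(z)=\exp\Bigl\{\sum_{k=1}^{\infty}\frac{d_k}{k}z^k\Bigr\}=\sum_{j=0}^{\infty}p_jz^j,\qquad |z|<1 .$$ Then all $p_j$ are positive real numbers. For every function $g(z)=\sum_{k=0}^{\infty}a_kz^k$ with complex coefficients $a_k$ that is analytic in the disc $|z|<1$, write $$S(g;j)=\sum_{k=0}^{j}k\,a_k\,p_{j-k}\qquad (j\ge 0).$$ Then for every integer $n\ge 1$ the series $\sum_{j>n}\frac{|S(g;j)|}{j}e^{-j/n}$ converges, and $$\left|\frac{1}{p_n}\sum_{k=0}^{n}a_kp_{n-k}-g(e^{-1/n})-\frac{S(g;n)}{n\,p_n}\right|\le c\left(\frac{1}{n^{\theta}}\sum_{j=1}^{n}\frac{|S(g;j)|}{p_j}\,j^{\theta-2}+\frac{1}{p(e^{-1/n})}\sum_{j>n}\frac{|S(g;j)|}{j}\,e^{-j/n}\right).$$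 -/

import Mathlib

namespace Voronoi

/-- The function `p(z) = exp (∑_{k ≥ 1} (d_k / k) z ^ k)` (only used for `‖z‖ < 1`;
the value `d 0` plays no role). -/
noncomputable def genFun (d : ℕ → ℝ) (z : ℂ) : ℂ :=
  Complex.exp (∑' k : ℕ, ((d (k + 1) : ℂ) / ((k : ℂ) + 1)) * z ^ (k + 1))

/-- The `j`-th Taylor coefficient `p_j` of `genFun d` at the origin. It is a real number, and
`re` only records it as an element of `ℝ`. -/
noncomputable def genCoeff (d : ℕ → ℝ) (j : ℕ) : ℝ :=
  (iteratedDeriv j (genFun d) 0 / (j.factorial : ℂ)).re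

/-- `S(g; j) = ∑_{k=0}^{j} a_k k p_{j-k}`, where `a` is the sequence of Taylor coefficients
of `g`. -/
noncomputable def S (p : ℕ → ℝ) (a : ℕ → ℂ) (j : ℕ) : ℂ :=
  ∑ k ∈ Finset.range (j + 1), a k * (k : ℂ) * (p (j - k) : ℂ)

/-- The Voronoi mean `(1 / p_n) ∑_{k=0}^{n} a_k p_{n-k}`. -/
noncomputable def mean (p : ℕ → ℝ) (a : ℕ → ℂ) (n : ℕ) : ℂ :=
  (1 / (p n : ℂ)) * ∑ k ∈ Finset.range (n + 1), a k * (p (n - k) : ℂ)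

end Voronoi

namespace Voronoi

open Filter Topology Finset

/-!
Write `r_n = exp (-1 / n)`. Since `∑ S(g; j) z ^ j = z g'(z) p(z)`, dividing by `p` and integrating
recovers `g` from the `S(g; j)`. In these terms the error is
`∑_{1 ≤ j ≤ n} S(g; j) (A_{nj} / p_n - B_{nj} - [j = n] / (n p_n)) - ∑_{j > n} S(g; j) B_{nj}` with
`A_{nj} = ∫_0^1 x ^ (j - 1) [z ^ (n - j)] (p(z) / p(x z)) dx` and
`B_{nj} = ∫_0^{r_n} x ^ (j - 1) / p(x) dx`, so it suffices to compare `A_{nj} / p_n` with `B_{nj}`.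
For `j` comparable to `n` both are small. For `8 j ≤ n` and `x ≤ r_n` the coefficient of
`z ^ (n - j)` in `p(z) / p(x z)` differs from `p_n / p(x)` by
`O(p_n / p(x) * ((1 + j (1 - x)) / (n (1 - x))) ^ θ)`, which follows from the recurrence
`n p_n = ∑ d_k p_{n-k}` and the growth `p(y) ≥ p(x) ((1 - x) / (1 - y)) ^ θ`; integrating in `x`
yields the weight `(j / n) ^ θ / (j p(r_j))`.
-/

section TaylorCoefficients

lemma iteratedDeriv_mul_div_factorial {𝕜 : Type*} [NontriviallyNormedField 𝕜] [CharZero 𝕜]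
    {f g : 𝕜 → 𝕜} {x : 𝕜} {n : ℕ} (hf : ContDiffAt 𝕜 n f x) (hg : ContDiffAt 𝕜 n g x) :
    iteratedDeriv n (f * g) x / (n.factorial : 𝕜) = ∑ i ∈ range (n + 1),
      iteratedDeriv i f x / (i.factorial : 𝕜) *
        (iteratedDeriv (n - i) g x / ((n - i).factorial : 𝕜)) := by
  rw [iteratedDeriv_mul hf hg, Finset.sum_div]
  refine Finset.sum_congr rfl fun i hi => ?_
  rw [Nat.cast_choose 𝕜 (mem_range_succ_iff.1 hi)]
  have hn : (n.factorial : 𝕜) ≠ 0 := Nat.cast_ne_zero.2 n.factorial_ne_zero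
  field_simp

lemma hasFPowerSeriesAt_tsum {c : ℕ → ℂ} {D : ℝ} (hc : ∀ k, ‖c k‖ ≤ D) :
    HasFPowerSeriesAt (fun z : ℂ => ∑' k, c k * z ^ k)
      (FormalMultilinearSeries.ofScalars ℂ c) 0 := by
  set F := FormalMultilinearSeries.ofScalars ℂ c
  have hradius : 1 ≤ F.radius := by
    simpa using F.le_radius_of_bound (r := 1) D fun n => by
      simpa [F, FormalMultilinearSeries.ofScalars_norm] using hc n
  convert (F.hasFPowerSeriesOnBall (one_pos.trans_le hradius)).hasFPowerSeriesAt using 1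
  funext z
  exact (FormalMultilinearSeries.ofScalars_sum_eq c z).symm

lemma iteratedDeriv_tsum_div_factorial {c : ℕ → ℂ} {D : ℝ} (hc : ∀ k, ‖c k‖ ≤ D) (n : ℕ) :
    iteratedDeriv n (fun z : ℂ => ∑' k, c k * z ^ k) 0 / (n.factorial : ℂ) = c n := by
  have h := hasFPowerSeriesAt_tsum hc
  exact (congrFun (FormalMultilinearSeries.ofScalars_series_injective ℂ ℂ
    (h.eq_formalMultilinearSeries h.analyticAt.hasFPowerSeriesAt)) n).symm

end TaylorCoefficients

/-- Boundedness of the exponent sequence `e`, which makes `genFun e` analytic in the open unit disc.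
The value `e 0` does not enter `genFun e`, hence the shift. -/
def BddExponent (e : ℕ → ℝ) : Prop := ∃ D, ∀ k, |e (k + 1)| ≤ D

namespace BddExponent

variable {e f : ℕ → ℝ}

lemma of_mem_Icc {a b : ℝ} (h : ∀ k, e (k + 1) ∈ Set.Icc a b) : BddExponent e :=
  ⟨max |a| |b|, fun k => abs_le_max_abs_abs (h k).1 (h k).2⟩

lemma const (s : ℝ) : BddExponent fun _ => s := ⟨|s|, fun _ => le_rfl⟩

lemma neg (he : BddExponent e) : BddExponent (-e) :=
  he.imp fun _ h k => by simpa using h k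

lemma add (he : BddExponent e) (hf : BddExponent f) : BddExponent (e + f) := by
  obtain ⟨⟨D, hD⟩, E, hE⟩ := And.intro he hf
  exact ⟨D + E, fun k => (abs_add_le _ _).trans (add_le_add (hD k) (hE k))⟩

lemma sub (he : BddExponent e) (hf : BddExponent f) : BddExponent (e - f) :=
  sub_eq_add_neg e f ▸ he.add hf.neg

end BddExponent

section GenFun

variable {e f : ℕ → ℝ} {z : ℂ}

lemma summable_exponent (he : BddExponent e) (hz : ‖z‖ < 1) :
    Summable fun k : ℕ => ((e (k + 1) : ℂ) / ((k : ℂ) + 1)) * z ^ (k + 1) := by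
  obtain ⟨D, hD⟩ := he
  refine .of_norm_bounded ((summable_geometric_of_lt_one (norm_nonneg z) hz).mul_left D) fun k => ?_
  have hk : ‖(k : ℂ) + 1‖ = k + 1 := by exact_mod_cast Complex.norm_natCast (k + 1)
  rw [norm_mul, norm_pow, norm_div, hk, Complex.norm_real, Real.norm_eq_abs]
  exact mul_le_mul ((div_le_self (abs_nonneg _) (by simp)).trans (hD k))
    (pow_le_pow_of_le_one (norm_nonneg z) hz.le k.le_succ) (by positivity)
    ((abs_nonneg _).trans (hD 0))

lemma genFun_add (he : BddExponent e) (hf : BddExponent f) (hz : ‖z‖ < 1) :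
    genFun (e + f) z = genFun e z * genFun f z := by
  rw [genFun, genFun, genFun, ← Complex.exp_add,
    ← (summable_exponent he hz).tsum_add (summable_exponent hf hz)]
  congr 1
  refine tsum_congr fun k => ?_
  push_cast [Pi.add_apply]
  ring

lemma genFun_zero_right (e : ℕ → ℝ) : genFun e 0 = 1 := by simp [genFun]

lemma hasDerivAt_genFun (he : BddExponent e) (hz : ‖z‖ < 1) :
    HasDerivAt (genFun e) ((∑' k, (e (k + 1) : ℂ) * z ^ k) * genFun e z) z := by
  obtain ⟨D, hD⟩ := he
  obtain ⟨r, hzr, hr1⟩ := exists_between hz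
  have hr0 : 0 < r := (norm_nonneg z).trans_lt hzr
  suffices HasDerivAt (fun w : ℂ => ∑' k : ℕ, (e (k + 1) : ℂ) / ((k : ℂ) + 1) * w ^ (k + 1))
      (∑' k, (e (k + 1) : ℂ) * z ^ k) z by
    rw [mul_comm]
    exact this.cexp
  refine hasDerivAt_tsum_of_isPreconnected (g' := fun k w => (e (k + 1) : ℂ) * w ^ k)
    (u := fun k => D * r ^ k) (t := Metric.ball (0 : ℂ) r) (y₀ := 0)
    ((summable_geometric_of_lt_one hr0.le hr1).mul_left D) Metric.isOpen_ball
    (convex_ball _ _).isPreconnected (fun k w _ => ?_) (fun k w hw => ?_) (by simpa)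
    (by simp) (by simpa)
  · have hk : (k : ℂ) + 1 ≠ 0 := Nat.cast_add_one_ne_zero k
    have h := (hasDerivAt_pow (k + 1) w).const_mul ((e (k + 1) : ℂ) / ((k : ℂ) + 1))
    rwa [← mul_assoc, Nat.cast_succ, div_mul_cancel₀ _ hk, Nat.add_sub_cancel] at h
  · rw [norm_mul, norm_pow, Complex.norm_real]
    exact mul_le_mul (hD k) (pow_le_pow_left₀ (norm_nonneg w) (mem_ball_zero_iff.1 hw).le k)
      (by positivity) ((abs_nonneg _).trans (hD 0))

lemma differentiableOn_genFun (he : BddExponent e) :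
    DifferentiableOn ℂ (genFun e) (Metric.ball 0 1) := fun _ hz =>
  (hasDerivAt_genFun he (mem_ball_zero_iff.1 hz)).differentiableAt.differentiableWithinAt

lemma analyticAt_genFun_zero (he : BddExponent e) : AnalyticAt ℂ (genFun e) 0 :=
  (differentiableOn_genFun he).analyticAt (Metric.ball_mem_nhds _ one_pos)

lemma iteratedDeriv_genFun_succ_div_factorial (he : BddExponent e) (n : ℕ) :
    iteratedDeriv (n + 1) (genFun e) 0 / ((n + 1).factorial : ℂ) * ((n + 1 : ℝ) : ℂ) =
      ∑ k ∈ range (n + 1), (e (k + 1) : ℂ) *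
        (iteratedDeriv (n - k) (genFun e) 0 / ((n - k).factorial : ℂ)) := by
  obtain ⟨D, hD⟩ := id he
  have hnorm : ∀ k, ‖(e (k + 1) : ℂ)‖ ≤ D := fun k => by simpa using hD k
  have hderiv : deriv (genFun e) =ᶠ[𝓝 0]
      (fun z => ∑' k, (e (k + 1) : ℂ) * z ^ k) * genFun e := by
    filter_upwards [Metric.ball_mem_nhds (0 : ℂ) one_pos] with z hz
    exact (hasDerivAt_genFun he (mem_ball_zero_iff.1 hz)).deriv
  have hmul := iteratedDeriv_mul_div_factorial (n := n)
    (hasFPowerSeriesAt_tsum hnorm).analyticAt.contDiffAt (analyticAt_genFun_zero he).contDiffAt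
  simp only [iteratedDeriv_tsum_div_factorial hnorm] at hmul
  rw [← hmul, iteratedDeriv_succ', hderiv.iteratedDeriv_eq n, Nat.factorial_succ]
  have hn : (n : ℂ) + 1 ≠ 0 := Nat.cast_add_one_ne_zero n
  push_cast
  field_simp

end GenFun

section GenCoeff

variable {e f : ℕ → ℝ}

lemma ofReal_genCoeff (he : BddExponent e) (n : ℕ) :
    (genCoeff e n : ℂ) = iteratedDeriv n (genFun e) 0 / (n.factorial : ℂ) := by
  suffices (iteratedDeriv n (genFun e) 0 / (n.factorial : ℂ)).im = 0 from
    Complex.ext (by simp [genCoeff]) (by simp [this])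
  induction n using Nat.strong_induction_on with
  | _ n ih =>
    rcases n with _ | n
    · simp [genFun_zero_right]
    · have h := congrArg Complex.im (iteratedDeriv_genFun_succ_div_factorial he n)
      rw [Complex.im_mul_ofReal, Complex.im_sum, Finset.sum_eq_zero fun k _ => by
        rw [Complex.im_ofReal_mul, ih (n - k) (by lia), mul_zero]] at h
      exact (mul_eq_zero.1 h).resolve_right (by positivity)

lemma genCoeff_zero (e : ℕ → ℝ) : genCoeff e 0 = 1 := by
  simp [genCoeff, genFun_zero_right]

lemma genCoeff_succ (he : BddExponent e) (n : ℕ) :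
    ((n : ℝ) + 1) * genCoeff e (n + 1) =
      ∑ k ∈ range (n + 1), e (k + 1) * genCoeff e (n - k) := by
  have h := iteratedDeriv_genFun_succ_div_factorial he n
  simp only [← ofReal_genCoeff he] at h
  rw [mul_comm]
  exact_mod_cast h

lemma genCoeff_add (he : BddExponent e) (hf : BddExponent f) (n : ℕ) :
    genCoeff (e + f) n = ∑ i ∈ range (n + 1), genCoeff e i * genCoeff f (n - i) := by
  have hmul : genFun (e + f) =ᶠ[𝓝 0] genFun e * genFun f := by
    filter_upwards [Metric.ball_mem_nhds (0 : ℂ) one_pos] with z hz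
    exact genFun_add he hf (mem_ball_zero_iff.1 hz)
  rw [← Complex.ofReal_inj, ofReal_genCoeff (he.add hf), hmul.iteratedDeriv_eq n,
    iteratedDeriv_mul_div_factorial (analyticAt_genFun_zero he).contDiffAt
      (analyticAt_genFun_zero hf).contDiffAt]
  push_cast [ofReal_genCoeff he, ofReal_genCoeff hf]
  rfl

lemma genCoeff_nonneg {D : ℝ} (he : ∀ k, e (k + 1) ∈ Set.Icc 0 D) (n : ℕ) :
    0 ≤ genCoeff e n := by
  induction n using Nat.strong_induction_on with
  | _ n ih =>
    rcases n with _ | n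
    · simp [genCoeff_zero]
    · refine nonneg_of_mul_nonneg_right (a := (n : ℝ) + 1) ?_ (by positivity)
      rw [genCoeff_succ (.of_mem_Icc he)]
      exact Finset.sum_nonneg fun k _ => mul_nonneg (he k).1 (ih _ (by lia))

lemma genCoeff_pos (he : BddExponent e) (h0 : ∀ k, 0 < e (k + 1)) (n : ℕ) :
    0 < genCoeff e n := by
  induction n using Nat.strong_induction_on with
  | _ n ih =>
    rcases n with _ | n
    · simp [genCoeff_zero]
    · refine pos_of_mul_pos_right (a := (n : ℝ) + 1) ?_ (by positivity)
      rw [genCoeff_succ he]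
      exact Finset.sum_pos (fun k _ => mul_pos (h0 k) (ih _ (by lia))) (by simp)

lemma hasSum_genCoeff (he : BddExponent e) {z : ℂ} (hz : ‖z‖ < 1) :
    HasSum (fun j : ℕ => (genCoeff e j : ℂ) * z ^ j) (genFun e z) := by
  refine (Complex.hasSum_taylorSeries_on_ball (differentiableOn_genFun he)
    (mem_ball_zero_iff.2 hz)).congr_fun fun j => ?_
  rw [ofReal_genCoeff he, smul_eq_mul, smul_eq_mul, sub_zero]
  ring

end GenCoeff

/-- The values of `genFun e` on the real axis, as real numbers. -/
noncomputable def genReal (e : ℕ → ℝ) (x : ℝ) : ℝ :=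
  Real.exp (∑' k : ℕ, e (k + 1) / ((k : ℝ) + 1) * x ^ (k + 1))

lemma genFun_ofReal (e : ℕ → ℝ) (x : ℝ) : genFun e (x : ℂ) = (genReal e x : ℂ) := by
  simp [genFun, genReal, Complex.ofReal_tsum]

lemma genReal_pos (e : ℕ → ℝ) (x : ℝ) : 0 < genReal e x := Real.exp_pos _

lemma genReal_neg (e : ℕ → ℝ) (x : ℝ) : genReal (-e) x = (genReal e x)⁻¹ := by
  simp only [genReal, ← Real.exp_neg, ← tsum_neg, Pi.neg_apply, neg_div, neg_mul]

lemma genReal_const (s : ℝ) {x : ℝ} (hx0 : 0 ≤ x) (hx : x < 1) :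
    genReal (fun _ => s) x = (1 - x) ^ (-s) := by
  have h := (Real.hasSum_pow_div_log_of_abs_lt_one (by rwa [abs_of_nonneg hx0])).mul_left s
  rw [Real.rpow_def_of_pos (by linarith), genReal, mul_neg, ← neg_mul, neg_mul_comm, mul_comm,
    neg_mul, ← mul_neg, ← h.tsum_eq]
  congr 1
  exact tsum_congr fun k => by ring

section GenReal

variable {e f : ℕ → ℝ} {x y : ℝ}

lemma genReal_add (he : BddExponent e) (hf : BddExponent f) (hx0 : 0 ≤ x) (hx : x < 1) :
    genReal (e + f) x = genReal e x * genReal f x := by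
  have h := genFun_add he hf (z := (x : ℂ)) (by simpa [abs_of_nonneg hx0] using hx)
  rw [genFun_ofReal, genFun_ofReal, genFun_ofReal] at h
  exact_mod_cast h

lemma genReal_sub (he : BddExponent e) (hf : BddExponent f) (hx0 : 0 ≤ x) (hx : x < 1) :
    genReal (e - f) x = genReal e x / genReal f x := by
  rw [sub_eq_add_neg, genReal_add he hf.neg hx0 hx, genReal_neg, div_eq_mul_inv]

lemma hasSum_genReal (he : BddExponent e) (hx0 : 0 ≤ x) (hx : x < 1) :
    HasSum (fun j : ℕ => genCoeff e j * x ^ j) (genReal e x) := by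
  have h := hasSum_genCoeff he (z := (x : ℂ)) (by simpa [abs_of_nonneg hx0] using hx)
  rw [genFun_ofReal] at h
  rw [← Complex.hasSum_ofReal]
  simpa using h

lemma genReal_mono {D : ℝ} (he : ∀ k, e (k + 1) ∈ Set.Icc 0 D) (hx0 : 0 ≤ x) (hxy : x ≤ y)
    (hy : y < 1) : genReal e x ≤ genReal e y :=
  hasSum_le (fun j => mul_le_mul_of_nonneg_left (pow_le_pow_left₀ hx0 hxy j)
    (genCoeff_nonneg he j)) (hasSum_genReal (.of_mem_Icc he) hx0 (hxy.trans_lt hy))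
    (hasSum_genReal (.of_mem_Icc he) (hx0.trans hxy) hy)

lemma genReal_mul_genReal_le (he : BddExponent e) (hf : BddExponent f)
    (hfe : ∀ k, f (k + 1) ≤ e (k + 1)) (hx0 : 0 ≤ x) (hxy : x ≤ y) (hy : y < 1) :
    genReal e x * genReal f y ≤ genReal e y * genReal f x := by
  obtain ⟨D, hD⟩ := he.sub hf
  have h := genReal_mono (fun k => ⟨sub_nonneg.2 (hfe k), (le_abs_self _).trans (hD k)⟩) hx0 hxy hy
  rwa [genReal_sub he hf hx0 (hxy.trans_lt hy), genReal_sub he hf (hx0.trans hxy) hy,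
    div_le_div_iff₀ (genReal_pos f x) (genReal_pos f y)] at h

lemma div_one_sub_rpow (s : ℝ) (hx0 : 0 ≤ x) (hxy : x ≤ y) (hy : y < 1) :
    ((1 - x) / (1 - y)) ^ s = genReal (fun _ => s) y / genReal (fun _ => s) x := by
  have hx1 : 0 < 1 - x := by linarith
  have hy1 : 0 < 1 - y := by linarith
  rw [genReal_const s hx0 (by linarith), genReal_const s (hx0.trans hxy) hy,
    Real.div_rpow hx1.le hy1.le, Real.rpow_neg hx1.le, Real.rpow_neg hy1.le, div_inv_eq_mul,
    div_eq_inv_mul]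

lemma genReal_le_mul_rpow {s : ℝ} (he : BddExponent e) (hs : ∀ k, e (k + 1) ≤ s) (hx0 : 0 ≤ x)
    (hxy : x ≤ y) (hy : y < 1) : genReal e y ≤ genReal e x * ((1 - x) / (1 - y)) ^ s := by
  rw [div_one_sub_rpow s hx0 hxy hy, ← mul_div_assoc, le_div_iff₀ (genReal_pos _ _), mul_comm,
    mul_comm (genReal e x)]
  exact genReal_mul_genReal_le (.const s) he hs hx0 hxy hy

lemma mul_rpow_le_genReal {s : ℝ} (he : BddExponent e) (hs : ∀ k, s ≤ e (k + 1)) (hx0 : 0 ≤ x)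
    (hxy : x ≤ y) (hy : y < 1) : genReal e x * ((1 - x) / (1 - y)) ^ s ≤ genReal e y := by
  rw [div_one_sub_rpow s hx0 hxy hy, ← mul_div_assoc, div_le_iff₀ (genReal_pos _ _)]
  exact genReal_mul_genReal_le he (.const s) hs hx0 hxy hy

end GenReal

/-- The exponents of `p(x z)` as a function of `z`, where `e` are the exponents of `p`. -/
def dilate (x : ℝ) (e : ℕ → ℝ) : ℕ → ℝ := fun k => e k * x ^ k

section Dilate

variable {e : ℕ → ℝ} {x : ℝ}

lemma BddExponent.dilate (he : BddExponent e) (hx : x ∈ Set.Icc 0 1) :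
    BddExponent (dilate x e) := by
  refine he.imp fun D hD k => ?_
  rw [Voronoi.dilate, abs_mul, abs_of_nonneg (pow_nonneg hx.1 _)]
  exact (mul_le_of_le_one_right (abs_nonneg _) (pow_le_one₀ hx.1 hx.2)).trans (hD k)

lemma genReal_dilate (e : ℕ → ℝ) (x y : ℝ) : genReal (dilate x e) y = genReal e (x * y) := by
  unfold genReal dilate
  congr 1
  refine tsum_congr fun k => ?_
  rw [mul_pow]
  ring

lemma genCoeff_dilate (he : BddExponent e) (hx : x ∈ Set.Icc 0 1) (n : ℕ) :
    genCoeff (dilate x e) n = x ^ n * genCoeff e n := by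
  induction n using Nat.strong_induction_on with
  | _ n ih =>
    rcases n with _ | n
    · simp [genCoeff_zero]
    · refine mul_left_cancel₀ (a := (n : ℝ) + 1) (by positivity) ?_
      rw [genCoeff_succ (he.dilate hx), mul_left_comm, genCoeff_succ he, Finset.mul_sum]
      refine Finset.sum_congr rfl fun k hk => ?_
      have hkn : k ≤ n := mem_range_succ_iff.1 hk
      rw [ih (n - k) (by lia), dilate, show n + 1 = (k + 1) + (n - k) by lia, pow_add]
      ring

end Dilate

/-- The radius `e ^ (-1 / n)` at which the Abel mean is compared with the `n`-th Voronoi mean. -/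
noncomputable def radius (n : ℕ) : ℝ := Real.exp (-1 / (n : ℝ))

section Radius

variable {m n : ℕ}

lemma radius_pos (n : ℕ) : 0 < radius n := Real.exp_pos _

lemma radius_lt_one (hn : 1 ≤ n) : radius n < 1 :=
  Real.exp_lt_one_iff.2 (div_neg_of_neg_of_pos (by norm_num) (by exact_mod_cast hn))

lemma one_sub_radius_le (n : ℕ) : 1 - radius n ≤ 1 / n := by
  have h := Real.one_sub_le_exp_neg (1 / (n : ℝ))
  rw [← neg_div] at h
  rw [radius]
  linarith

lemma radius_le_mul_one_sub_radius (hn : 1 ≤ n) : radius n ≤ n * (1 - radius n) := by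
  have hn0 : (0 : ℝ) < n := by exact_mod_cast hn
  have hinv : radius n * Real.exp (1 / (n : ℝ)) = 1 := by
    rw [radius, ← Real.exp_add, ← add_div]
    simp
  have hle : radius n * (1 / (n : ℝ) + 1) ≤ 1 :=
    (mul_le_mul_of_nonneg_left (Real.add_one_le_exp _) (radius_pos n).le).trans hinv.le
  field_simp at hle
  linarith

lemma one_div_le_one_sub_radius (hn : 1 ≤ n) : 1 / (2 * n : ℝ) ≤ 1 - radius n := by
  have hn1 : (1 : ℝ) ≤ n := by exact_mod_cast hn
  rw [div_le_iff₀ (by positivity)]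
  nlinarith [radius_le_mul_one_sub_radius hn, radius_lt_one hn]

lemma radius_mono (hm : 1 ≤ m) (hmn : m ≤ n) : radius m ≤ radius n := by
  have : (0 : ℝ) < m := by exact_mod_cast hm
  rw [radius, radius, Real.exp_le_exp, neg_div, neg_div, neg_le_neg_iff]
  gcongr

lemma radius_pow (n m : ℕ) : radius n ^ m = Real.exp (-(m : ℝ) / n) := by
  rw [radius, ← Real.exp_nat_mul]
  ring_nf

lemma one_le_three_mul_radius_pow (hmn : m ≤ n) : 1 ≤ 3 * radius n ^ m := by
  have h : Real.exp (-1) ≤ radius n ^ m := by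
    rw [radius_pow, Real.exp_le_exp, neg_div, neg_le_neg_iff]
    exact div_le_one_of_le₀ (by exact_mod_cast hmn) (by positivity)
  linarith [Real.exp_neg_one_gt_d9]

end Radius

section CoefficientBounds

variable {e : ℕ → ℝ}

lemma sum_genCoeff_mul_pow_le {D : ℝ} (he : ∀ k, e (k + 1) ∈ Set.Icc 0 D) {x : ℝ} (hx0 : 0 ≤ x)
    (hx : x < 1) (s : Finset ℕ) : ∑ m ∈ s, genCoeff e m * x ^ m ≤ genReal e x :=
  sum_le_hasSum s (fun m _ => mul_nonneg (genCoeff_nonneg he m) (pow_nonneg hx0 m))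
    (hasSum_genReal (.of_mem_Icc he) hx0 hx)

lemma sum_genCoeff_le {D : ℝ} (he : ∀ k, e (k + 1) ∈ Set.Icc 0 D) {n : ℕ} (hn : 1 ≤ n) :
    ∑ m ∈ range (n + 1), genCoeff e m ≤ 3 * genReal e (radius n) := by
  calc ∑ m ∈ range (n + 1), genCoeff e m
      ≤ ∑ m ∈ range (n + 1), 3 * (genCoeff e m * radius n ^ m) := by
        refine sum_le_sum fun m hm => ?_
        nlinarith [genCoeff_nonneg he m, one_le_three_mul_radius_pow (mem_range_succ_iff.1 hm)]
    _ ≤ 3 * genReal e (radius n) := by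
        rw [← mul_sum]
        gcongr
        exact sum_genCoeff_mul_pow_le he (radius_pos n).le (radius_lt_one hn) _

lemma mul_genCoeff_eq_sum (he : BddExponent e) (n : ℕ) :
    (n : ℝ) * genCoeff e n = ∑ m ∈ range n, e (n - 1 - m + 1) * genCoeff e m := by
  rcases n with _ | n
  · simp
  · rw [Nat.cast_succ, genCoeff_succ he, ← sum_range_reflect]
    refine sum_congr rfl fun m hm => ?_
    rw [show n + 1 - 1 - m = n - m by lia, Nat.sub_sub_self (mem_range_succ_iff.1 hm)]

lemma mul_genCoeff_le_sum {D B : ℝ} (he : ∀ k, e (k + 1) ∈ Set.Icc 0 D) {n : ℕ}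
    (hB : ∀ k < n, e (k + 1) ≤ B) :
    (n : ℝ) * genCoeff e n ≤ B * ∑ m ∈ range n, genCoeff e m := by
  rw [mul_genCoeff_eq_sum (.of_mem_Icc he), mul_sum]
  refine sum_le_sum fun m hm => mul_le_mul_of_nonneg_right (hB _ ?_) (genCoeff_nonneg he m)
  have := mem_range.1 hm
  lia

lemma sum_le_mul_genCoeff {b D : ℝ} (hb0 : 0 ≤ b) (he : ∀ k, e (k + 1) ∈ Set.Icc b D) (n : ℕ) :
    b * ∑ m ∈ range n, genCoeff e m ≤ (n : ℝ) * genCoeff e n := by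
  rw [mul_genCoeff_eq_sum (.of_mem_Icc he), mul_sum]
  exact sum_le_sum fun m _ => mul_le_mul_of_nonneg_right (he _).1
    (genCoeff_nonneg (fun k => Set.Icc_subset_Icc_left hb0 (he k)) m)

lemma mul_genCoeff_le {D : ℝ} (he : ∀ k, e (k + 1) ∈ Set.Icc 0 D) {i n : ℕ} (hn : 1 ≤ n)
    (hin : i ≤ n) : (i : ℝ) * genCoeff e i ≤ 3 * D * genReal e (radius n) := by
  have hD0 : 0 ≤ D := (he 0).1.trans (he 0).2
  calc (i : ℝ) * genCoeff e i ≤ D * ∑ m ∈ range i, genCoeff e m :=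
        mul_genCoeff_le_sum he fun k _ => (he k).2
    _ ≤ D * ∑ m ∈ range (n + 1), genCoeff e m := by
        gcongr ?_ * ?_
        exact sum_le_sum_of_subset_of_nonneg (range_subset_range.2 (by lia))
          fun m _ _ => genCoeff_nonneg he m
    _ ≤ D * (3 * genReal e (radius n)) := mul_le_mul_of_nonneg_left (sum_genCoeff_le he hn) hD0
    _ = 3 * D * genReal e (radius n) := by ring

end CoefficientBounds

section ReverseBound

variable {e : ℕ → ℝ} {D : ℕ} {s : ℝ}

lemma one_sub_pow_le {x : ℝ} (hx0 : 0 ≤ x) (n : ℕ) : 1 - x ^ n ≤ n * (1 - x) := by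
  linarith [one_add_mul_sub_le_pow (by linarith : -1 ≤ x) n]

lemma genReal_le_two_pow_mul_genReal_sq (he : ∀ k, e (k + 1) ∈ Set.Icc (0 : ℝ) D) (hs0 : 0 ≤ s)
    (hs : s < 1) : genReal e s ≤ 2 ^ D * genReal e (s ^ 2) := by
  have hgrowth := genReal_le_mul_rpow (.of_mem_Icc he) (fun k => (he k).2) (sq_nonneg s)
    (by nlinarith : s ^ 2 ≤ s) hs
  have hratio : (1 - s ^ 2) / (1 - s) = 1 + s := by
    rw [div_eq_iff (by linarith)]
    ring
  rw [Real.rpow_natCast, hratio, mul_comm] at hgrowth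
  refine hgrowth.trans (mul_le_mul_of_nonneg_right ?_ (genReal_pos _ _).le)
  exact pow_le_pow_left₀ (by linarith) (by linarith) D

lemma genReal_sq_sub_sum_le (he : ∀ k, e (k + 1) ∈ Set.Icc (0 : ℝ) D) (hs0 : 0 ≤ s) (hs : s < 1)
    (M : ℕ) : genReal e (s ^ 2) - ∑ m ∈ range M, genCoeff e m * (s ^ 2) ^ m ≤
      2 ^ D * s ^ M * genReal e (s ^ 2) := by
  have hc : ∀ m, 0 ≤ genCoeff e m * s ^ m := fun m =>
    mul_nonneg (genCoeff_nonneg he m) (pow_nonneg hs0 m)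
  have htail_sq := (hasSum_nat_add_iff' M).2
    (hasSum_genReal (.of_mem_Icc he) (sq_nonneg s) (by nlinarith : s ^ 2 < 1))
  have htail := ((hasSum_nat_add_iff' M).2 (hasSum_genReal (.of_mem_Icc he) hs0 hs)).mul_left
    (s ^ M)
  calc genReal e (s ^ 2) - ∑ m ∈ range M, genCoeff e m * (s ^ 2) ^ m
      ≤ s ^ M * (genReal e s - ∑ m ∈ range M, genCoeff e m * s ^ m) := by
        refine hasSum_le (fun m => ?_) htail_sq htail
        rw [← pow_mul, two_mul, pow_add, mul_left_comm]
        exact mul_le_mul_of_nonneg_right (pow_le_pow_of_le_one hs0 hs.le (by lia)) (hc _)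
    _ ≤ s ^ M * (2 ^ D * genReal e (s ^ 2)) := by
        gcongr
        linarith [genReal_le_two_pow_mul_genReal_sq he hs0 hs,
          sum_nonneg fun m (_ : m ∈ range M) => hc m]
    _ = 2 ^ D * s ^ M * genReal e (s ^ 2) := by ring

lemma genReal_sq_le_two_mul_sum (he : ∀ k, e (k + 1) ∈ Set.Icc (0 : ℝ) D) (hs0 : 0 ≤ s)
    (hs : s < 1) {n : ℕ} (hsn : 2 ^ D * s ^ n ≤ 1 / 2) :
    genReal e (s ^ 2) ≤ 2 * ∑ m ∈ range n, genCoeff e m := by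
  have htail : 2 ^ D * s ^ n * genReal e (s ^ 2) ≤ 1 / 2 * genReal e (s ^ 2) :=
    mul_le_mul_of_nonneg_right hsn (genReal_pos _ _).le
  have hsum : ∑ m ∈ range n, genCoeff e m * (s ^ 2) ^ m ≤ ∑ m ∈ range n, genCoeff e m :=
    sum_le_sum fun m _ => mul_le_of_le_one_right (genCoeff_nonneg he m)
      (pow_le_one₀ (sq_nonneg s) (by nlinarith))
  linarith [genReal_sq_sub_sum_le he hs0 hs n]

lemma two_pow_mul_radius_pow_le {n : ℕ} (hn : 1 ≤ n) (D : ℕ) :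
    2 ^ D * (radius n ^ (D + 1)) ^ n ≤ 1 / 2 := by
  have hn0 : (n : ℝ) ≠ 0 := Nat.cast_ne_zero.2 (by lia)
  calc 2 ^ D * (radius n ^ (D + 1)) ^ n = 2 ^ D * Real.exp (-1) ^ (D + 1) := by
        rw [pow_right_comm, radius_pow, neg_div, div_self hn0]
    _ ≤ 2 ^ D * (1 / 2) ^ (D + 1) := by
        gcongr
        linarith [Real.exp_neg_one_lt_d9]
    _ = 1 / 2 := by rw [pow_succ, ← mul_assoc, ← mul_pow]; norm_num

lemma genReal_radius_le {b : ℝ} (hb0 : 0 < b) (he : ∀ k, e (k + 1) ∈ Set.Icc b D) {n : ℕ}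
    (hn : 1 ≤ n) :
    genReal e (radius n) ≤ 2 * (2 * (D + 1)) ^ D / b * (n * genCoeff e n) := by
  have he0 : ∀ k, e (k + 1) ∈ Set.Icc (0 : ℝ) D := fun k => Set.Icc_subset_Icc_left hb0.le (he k)
  have hr0 := (radius_pos n).le
  have hr1 : 0 < 1 - radius n := by linarith [radius_lt_one hn]
  set s : ℝ := radius n ^ (D + 1) with hs
  have hs0 : 0 ≤ s := pow_nonneg hr0 _
  have hs1 : s < 1 := pow_lt_one₀ hr0 (radius_lt_one hn) D.succ_ne_zero
  have hs_sq : s ^ 2 = radius n ^ (2 * (D + 1)) := by rw [hs, ← pow_mul, mul_comm]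
  have hs_le : s ^ 2 ≤ radius n := hs_sq ▸ pow_le_of_le_one hr0 (radius_lt_one hn).le (by lia)
  have hratio : (1 - s ^ 2) / (1 - radius n) ≤ 2 * (D + 1) := by
    rw [div_le_iff₀ hr1, hs_sq]
    exact_mod_cast one_sub_pow_le hr0 (2 * (D + 1))
  have hsum : genReal e (s ^ 2) ≤ 2 * (n * genCoeff e n / b) := by
    refine (genReal_sq_le_two_mul_sum he0 hs0 hs1 (two_pow_mul_radius_pow_le hn D)).trans ?_
    gcongr
    rw [le_div_iff₀ hb0, mul_comm]
    exact sum_le_mul_genCoeff hb0.le he n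
  calc genReal e (radius n)
      ≤ genReal e (s ^ 2) * ((1 - s ^ 2) / (1 - radius n)) ^ D := by
        simpa only [Real.rpow_natCast] using genReal_le_mul_rpow (.of_mem_Icc he0)
          (fun k => (he k).2) (sq_nonneg s) hs_le (radius_lt_one hn)
    _ ≤ 2 * (n * genCoeff e n / b) * (2 * (D + 1)) ^ D := by
        have : 0 ≤ (1 - s ^ 2) / (1 - radius n) := div_nonneg (by linarith) hr1.le
        gcongr
        exact (genReal_pos _ _).le.trans hsum
    _ = 2 * (2 * (D + 1)) ^ D / b * (n * genCoeff e n) := by ring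

end ReverseBound

/-- The exponents of `p(z) / p(x z)` as a function of `z`, where `e` are the exponents of `p`. -/
def quotExp (x : ℝ) (e : ℕ → ℝ) : ℕ → ℝ := e - dilate x e

section Quotient

variable {e : ℕ → ℝ} {x : ℝ}

lemma BddExponent.quotExp (he : BddExponent e) (hx : x ∈ Set.Icc 0 1) :
    BddExponent (quotExp x e) :=
  he.sub (he.dilate hx)

lemma quotExp_apply (x : ℝ) (e : ℕ → ℝ) (k : ℕ) : quotExp x e k = e k * (1 - x ^ k) := by
  rw [quotExp, Pi.sub_apply, dilate]
  ring

lemma quotExp_mem_Icc {D : ℝ} (he : ∀ k, e (k + 1) ∈ Set.Icc 0 D) (hx : x ∈ Set.Icc 0 1) (k : ℕ) :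
    quotExp x e (k + 1) ∈ Set.Icc 0 D := by
  rw [quotExp_apply]
  exact ⟨mul_nonneg (he k).1 (sub_nonneg.2 (pow_le_one₀ hx.1 hx.2)),
    (mul_le_of_le_one_right (he k).1 (sub_le_self _ (pow_nonneg hx.1 _))).trans (he k).2⟩

lemma genReal_quotExp (he : BddExponent e) (hx : x ∈ Set.Icc 0 1) {y : ℝ} (hy0 : 0 ≤ y)
    (hy : y < 1) : genReal (quotExp x e) y = genReal e y / genReal e (x * y) := by
  rw [quotExp, genReal_sub he (he.dilate hx) hy0 hy, genReal_dilate]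

lemma genCoeff_eq_sum_quotExp (he : BddExponent e) (hx : x ∈ Set.Icc 0 1) (n : ℕ) :
    genCoeff e n =
      ∑ m ∈ range (n + 1), x ^ m * genCoeff e m * genCoeff (quotExp x e) (n - m) := by
  have h := genCoeff_add (he.dilate hx) (he.quotExp hx) n
  rw [show dilate x e + quotExp x e = e from add_sub_cancel _ _] at h
  simpa only [genCoeff_dilate he hx] using h

lemma genCoeff_quotExp_eq_sum (he : BddExponent e) (hx : x ∈ Set.Icc 0 1) (n : ℕ) :
    genCoeff (quotExp x e) n =
      ∑ m ∈ range (n + 1), x ^ m * genCoeff (-e) m * genCoeff e (n - m) := by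
  have hquot : quotExp x e = dilate x (-e) + e := by
    funext k
    simp only [quotExp, dilate, Pi.sub_apply, Pi.add_apply, Pi.neg_apply]
    ring
  rw [hquot, genCoeff_add (he.neg.dilate hx) he]
  simp only [genCoeff_dilate he.neg hx]

lemma one_sub_mul_radius_div_le {n : ℕ} (hn : 1 ≤ n) (hx : x ≤ 1) :
    (1 - x * radius n) / (1 - radius n) ≤ 1 + n * (1 - x) := by
  rw [div_le_iff₀ (sub_pos.2 (radius_lt_one hn))]
  nlinarith [mul_le_mul_of_nonneg_right (radius_le_mul_one_sub_radius hn) (sub_nonneg.2 hx)]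

lemma genReal_quotExp_radius_le {D : ℝ} (he : ∀ k, e (k + 1) ∈ Set.Icc 0 D)
    (hx : x ∈ Set.Icc 0 1) {n : ℕ} (hn : 1 ≤ n) :
    genReal (quotExp x e) (radius n) ≤ (1 + n * (1 - x)) ^ D := by
  have hr0 := (radius_pos n).le
  have hr1 := radius_lt_one hn
  have hxr : x * radius n ≤ radius n := mul_le_of_le_one_left hr0 hx.2
  rw [genReal_quotExp (.of_mem_Icc he) hx hr0 hr1, div_le_iff₀' (genReal_pos _ _)]
  calc genReal e (radius n)
      ≤ genReal e (x * radius n) * ((1 - x * radius n) / (1 - radius n)) ^ D :=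
        genReal_le_mul_rpow (.of_mem_Icc he) (fun k => (he k).2) (mul_nonneg hx.1 hr0) hxr hr1
    _ ≤ genReal e (x * radius n) * (1 + n * (1 - x)) ^ D := by
        gcongr
        · exact (genReal_pos _ _).le
        · exact div_nonneg (by linarith) (by linarith)
        · exact (he 0).1.trans (he 0).2
        · exact one_sub_mul_radius_div_le hn hx.2

lemma sum_genCoeff_quotExp_le {D : ℝ} (he : ∀ k, e (k + 1) ∈ Set.Icc 0 D)
    (hx : x ∈ Set.Icc 0 1) {n : ℕ} (hn : 1 ≤ n) :
    ∑ m ∈ range n, genCoeff (quotExp x e) m ≤ 3 * (1 + n * (1 - x)) ^ D :=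
  have hq := quotExp_mem_Icc he hx
  calc ∑ m ∈ range n, genCoeff (quotExp x e) m
      ≤ ∑ m ∈ range (n + 1), genCoeff (quotExp x e) m :=
        sum_le_sum_of_subset_of_nonneg (range_subset_range.2 n.le_succ)
          fun m _ _ => genCoeff_nonneg hq m
    _ ≤ 3 * genReal (quotExp x e) (radius n) := sum_genCoeff_le hq hn
    _ ≤ 3 * (1 + n * (1 - x)) ^ D := by gcongr; exact genReal_quotExp_radius_le he hx hn

lemma genCoeff_quotExp_le {D : ℝ} (he : ∀ k, e (k + 1) ∈ Set.Icc 0 D)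
    (hx : x ∈ Set.Icc 0 1) {n : ℕ} (hn : 1 ≤ n) :
    genCoeff (quotExp x e) n ≤ 3 * D * (1 - x) * (1 + n * (1 - x)) ^ D := by
  have hD : 0 ≤ D := (he 0).1.trans (he 0).2
  have hx1 : 0 ≤ 1 - x := sub_nonneg.2 hx.2
  have hbound : ∀ k < n, quotExp x e (k + 1) ≤ D * (n * (1 - x)) := fun k hk => by
    rw [quotExp_apply]
    refine mul_le_mul (he k).2 ((one_sub_pow_le hx.1 _).trans ?_)
      (sub_nonneg.2 (pow_le_one₀ hx.1 hx.2)) hD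
    gcongr
    exact hk
  have hn0 : (0 : ℝ) < n := by exact_mod_cast hn
  refine le_of_mul_le_mul_left ?_ hn0
  calc n * genCoeff (quotExp x e) n
      ≤ D * (n * (1 - x)) * ∑ m ∈ range n, genCoeff (quotExp x e) m :=
        mul_genCoeff_le_sum (quotExp_mem_Icc he hx) hbound
    _ ≤ D * (n * (1 - x)) * (3 * (1 + n * (1 - x)) ^ D) := by
        gcongr; exact sum_genCoeff_quotExp_le he hx hn
    _ = n * (3 * D * (1 - x) * (1 + n * (1 - x)) ^ D) := by ring

end Quotient

section LagDifference

variable {a : ℕ → ℝ} {t : ℕ}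

/-- The coefficients of `(1 - z ^ t) * ∑ i, a i * z ^ i`. -/
def lagDiff (a : ℕ → ℝ) (t i : ℕ) : ℝ := a i - if t ≤ i then a (i - t) else 0

lemma lagDiff_add (a : ℕ → ℝ) (t i : ℕ) : lagDiff a t (t + i) = a (t + i) - a i := by
  simp [lagDiff]

lemma lagDiff_of_lt {i : ℕ} (h : i < t) : lagDiff a t i = a i := by
  simp [lagDiff, h.not_ge]

lemma sum_abs_lagDiff_le (ha0 : ∀ i, 0 ≤ a i) (ha : Antitone a) (t n : ℕ) :
    ∑ i ∈ range (t + n), |lagDiff a t i| ≤ 2 * ∑ i ∈ range t, a i := by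
  have hhead : ∑ i ∈ range t, |lagDiff a t i| = ∑ i ∈ range t, a i :=
    sum_congr rfl fun i hi => by rw [lagDiff_of_lt (mem_range.1 hi), abs_of_nonneg (ha0 i)]
  have htail : ∑ i ∈ range n, |lagDiff a t (t + i)| =
      ∑ i ∈ range n, a i - ∑ i ∈ range n, a (t + i) := by
    rw [← sum_sub_distrib]
    refine sum_congr rfl fun i _ => ?_
    rw [lagDiff_add, abs_sub_comm, abs_of_nonneg (sub_nonneg.2 (ha (Nat.le_add_left i t)))]
  have hextend : ∑ i ∈ range n, a i ≤ ∑ i ∈ range t, a i + ∑ i ∈ range n, a (t + i) := by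
    rw [← sum_range_add]
    exact sum_le_sum_of_subset_of_nonneg (range_subset_range.2 (Nat.le_add_left n t))
      fun i _ _ => ha0 i
  rw [sum_range_add, hhead, htail]
  linarith

lemma sum_lagDiff_mul (a b : ℕ → ℝ) {n : ℕ} (htn : t ≤ n) :
    ∑ i ∈ range (n + 1), lagDiff a t i * b (n - i) =
      ∑ i ∈ range (n + 1), a i * b (n - i) - ∑ i ∈ range (n - t + 1), a i * b (n - t - i) := by
  have hn : n + 1 = t + (n - t + 1) := by lia
  rw [hn, sum_range_add _ t, sum_range_add _ t, add_sub_assoc, ← sum_sub_distrib]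
  congr 1
  · exact sum_congr rfl fun i hi => by rw [lagDiff_of_lt (mem_range.1 hi)]
  · refine sum_congr rfl fun i _ => ?_
    rw [lagDiff_add, Nat.sub_sub, sub_mul]

lemma abs_sum_mul_le_of_le_or_le {d b : ℕ → ℝ} {B C : ℝ} (hb : ∀ i, 0 ≤ b i) (hB : 0 ≤ B)
    (hC : 0 ≤ C) {n : ℕ} (h : ∀ i ≤ n, b (n - i) ≤ B ∨ |d i| ≤ C) :
    |∑ i ∈ range (n + 1), d i * b (n - i)| ≤
      B * ∑ i ∈ range (n + 1), |d i| + C * ∑ i ∈ range (n + 1), b i := by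
  rw [← sum_range_reflect b, mul_sum, mul_sum, ← sum_add_distrib]
  refine (abs_sum_le_sum_abs _ _).trans (sum_le_sum fun i hi => ?_)
  rw [abs_mul, abs_of_nonneg (hb _), Nat.add_sub_cancel]
  rcases h i (Nat.lt_succ_iff.1 (mem_range.1 hi)) with hi | hi
  · nlinarith [mul_le_mul_of_nonneg_right hi (abs_nonneg (d i)), mul_nonneg hC (hb (n - i))]
  · nlinarith [mul_le_mul_of_nonneg_right hi (hb (n - i)), mul_nonneg hB (abs_nonneg (d i))]

end LagDifference

section RatioCoefficients

variable {x θ : ℝ}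

/-- The coefficients of `((1 - x z) / (1 - z)) ^ θ`, the model case of a constant exponent. -/
noncomputable def ratioCoeff (x θ : ℝ) : ℕ → ℝ := genCoeff (quotExp x fun _ => θ)

lemma ratioCoeff_nonneg (hx : x ∈ Set.Icc 0 1) (hθ : 0 ≤ θ) (m : ℕ) : 0 ≤ ratioCoeff x θ m :=
  genCoeff_nonneg (quotExp_mem_Icc (fun _ => ⟨hθ, le_rfl⟩) hx) m

lemma succ_mul_ratioCoeff_succ_sub (hx : x ∈ Set.Icc 0 1) (θ : ℝ) (m : ℕ) :
    ((m : ℝ) + 1) * ratioCoeff x θ (m + 1) - m * ratioCoeff x θ m =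
      θ * (1 - x) * ∑ k ∈ range (m + 1), x ^ k * ratioCoeff x θ (m - k) := by
  have hrec := genCoeff_succ ((BddExponent.const θ).quotExp hx)
  have hm : (m : ℝ) * ratioCoeff x θ m =
      ∑ k ∈ range (m + 1), θ * (1 - x ^ k) * ratioCoeff x θ (m - k) := by
    cases m with
    | zero => simp
    | succ m =>
      rw [sum_range_succ', Nat.cast_succ, ratioCoeff, hrec m]
      simp [quotExp_apply]
  rw [hm, ratioCoeff, hrec m, ← sum_sub_distrib, mul_sum]
  refine sum_congr rfl fun k _ => ?_
  rw [quotExp_apply]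
  ring

lemma mul_sum_ratioCoeff_le (hx : x ∈ Set.Icc 0 1) (hθ : θ ∈ Set.Icc 0 1) (m : ℕ) :
    θ * (1 - x) * ∑ k ∈ range (m + 1), x ^ k * ratioCoeff x θ (m - k) ≤ ratioCoeff x θ m := by
  have hx1 : 0 ≤ 1 - x := sub_nonneg.2 hx.2
  induction m with
  | zero =>
    simp only [ratioCoeff, zero_add, range_one, sum_singleton, Nat.sub_zero, genCoeff_zero,
      pow_zero, mul_one]
    exact mul_le_one₀ hθ.2 hx1 (by linarith [hx.1])
  | succ m ih =>
    have hstep := succ_mul_ratioCoeff_succ_sub hx θ m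
    have hnext : ∑ k ∈ range (m + 2), x ^ k * ratioCoeff x θ (m + 1 - k) =
        x * ∑ k ∈ range (m + 1), x ^ k * ratioCoeff x θ (m - k) + ratioCoeff x θ (m + 1) := by
      rw [sum_range_succ', mul_sum]
      simp only [Nat.add_sub_add_right, pow_zero, one_mul, Nat.sub_zero, pow_succ', mul_assoc]
    rw [hnext]
    set W := ∑ k ∈ range (m + 1), x ^ k * ratioCoeff x θ (m - k)
    have hW : θ * (1 - x) * W ≤ ratioCoeff x θ (m + 1) := by
      have : (0 : ℝ) ≤ m := m.cast_nonneg
      nlinarith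
    calc θ * (1 - x) * (x * W + ratioCoeff x θ (m + 1))
        = x * (θ * (1 - x) * W) + θ * ((1 - x) * ratioCoeff x θ (m + 1)) := by ring
      _ ≤ x * ratioCoeff x θ (m + 1) + 1 * ((1 - x) * ratioCoeff x θ (m + 1)) := by
        have := mul_nonneg hx1 (ratioCoeff_nonneg hx hθ.1 (m + 1))
        gcongr
        exacts [hx.1, hθ.2]
      _ = ratioCoeff x θ (m + 1) := by ring

lemma ratioCoeff_antitone (hx : x ∈ Set.Icc 0 1) (hθ : θ ∈ Set.Icc 0 1) :
    Antitone (ratioCoeff x θ) :=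
  antitone_nat_of_succ_le fun m => by
    have hm : (0 : ℝ) < m + 1 := by positivity
    refine le_of_mul_le_mul_left ?_ hm
    linarith [succ_mul_ratioCoeff_succ_sub hx θ m, mul_sum_ratioCoeff_le hx hθ m]

lemma succ_mul_ratioCoeff_sub_succ_le (hx : x ∈ Set.Icc 0 1) (hθ : 0 ≤ θ) (m : ℕ) :
    ((m : ℝ) + 1) * (ratioCoeff x θ m - ratioCoeff x θ (m + 1)) ≤ ratioCoeff x θ m := by
  have hinc : 0 ≤ θ * (1 - x) * ∑ k ∈ range (m + 1), x ^ k * ratioCoeff x θ (m - k) :=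
    mul_nonneg (mul_nonneg hθ (sub_nonneg.2 hx.2)) <| sum_nonneg fun k _ =>
      mul_nonneg (pow_nonneg hx.1 k) (ratioCoeff_nonneg hx hθ _)
  linarith [succ_mul_ratioCoeff_succ_sub hx θ m]

lemma succ_mul_ratioCoeff_sub_le (hx : x ∈ Set.Icc 0 1) (hθ : θ ∈ Set.Icc 0 1) (m t : ℕ) :
    ((m : ℝ) + 1) * (ratioCoeff x θ m - ratioCoeff x θ (t + m)) ≤
      ∑ i ∈ range t, ratioCoeff x θ i := by
  have hanti := ratioCoeff_antitone hx hθ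
  have htelescope : ratioCoeff x θ m - ratioCoeff x θ (t + m) =
      ∑ i ∈ range t, (ratioCoeff x θ (m + i) - ratioCoeff x θ (m + i + 1)) := by
    rw [add_comm t m]
    exact (sum_range_sub' (fun i => ratioCoeff x θ (m + i)) t).symm
  rw [htelescope, mul_sum]
  refine sum_le_sum fun i _ => ?_
  calc ((m : ℝ) + 1) * (ratioCoeff x θ (m + i) - ratioCoeff x θ (m + i + 1))
      ≤ (((m + i : ℕ) : ℝ) + 1) * (ratioCoeff x θ (m + i) - ratioCoeff x θ (m + i + 1)) := by
        gcongr
        · exact sub_nonneg.2 (hanti (Nat.le_succ _))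
        · exact Nat.le_add_right m i
    _ ≤ ratioCoeff x θ (m + i) := succ_mul_ratioCoeff_sub_succ_le hx hθ.1 _
    _ ≤ ratioCoeff x θ i := hanti (Nat.le_add_left i m)

lemma abs_lagDiff_ratioCoeff_le (hx : x ∈ Set.Icc 0 1) (hθ : θ ∈ Set.Icc 0 1) {t i : ℕ}
    (hti : t ≤ i) :
    ((i - t : ℕ) + 1) * |lagDiff (ratioCoeff x θ) t i| ≤ ∑ i ∈ range t, ratioCoeff x θ i := by
  obtain ⟨m, rfl⟩ := Nat.exists_eq_add_of_le hti
  rw [lagDiff_add, abs_sub_comm, Nat.add_sub_cancel_left,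
    abs_of_nonneg (sub_nonneg.2 (ratioCoeff_antitone hx hθ (Nat.le_add_left m t)))]
  exact succ_mul_ratioCoeff_sub_le hx hθ m t

end RatioCoefficients

section Smoothness

variable {e : ℕ → ℝ} {D x θ : ℝ}

lemma quotExp_const_add_quotExp_sub (x θ : ℝ) (e : ℕ → ℝ) :
    quotExp x (fun _ => θ) + quotExp x (e - fun _ => θ) = quotExp x e := by
  funext k
  simp only [Pi.add_apply, quotExp_apply, Pi.sub_apply]
  ring

lemma sub_const_mem_Icc (hθ : 0 ≤ θ) (he : ∀ k, e (k + 1) ∈ Set.Icc θ D) (k : ℕ) :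
    (e - fun _ => θ : ℕ → ℝ) (k + 1) ∈ Set.Icc 0 D :=
  ⟨sub_nonneg.2 (he k).1, (sub_le_self _ hθ).trans (he k).2⟩

lemma genCoeff_quotExp_eq_sum_ratioCoeff (he : BddExponent e) (hx : x ∈ Set.Icc 0 1) (θ : ℝ)
    (n : ℕ) : genCoeff (quotExp x e) n = ∑ i ∈ range (n + 1),
      ratioCoeff x θ i * genCoeff (quotExp x (e - fun _ => θ)) (n - i) := by
  rw [← quotExp_const_add_quotExp_sub x θ e,
    genCoeff_add ((BddExponent.const θ).quotExp hx) ((he.sub (.const θ)).quotExp hx), ratioCoeff]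

-- For small `i` the remaining factor has index at least `3 n / 8` and is `O(K / n)`; for large `i`
-- the lag difference of `ratioCoeff` is `O(1 / n)`.
lemma abs_genCoeff_quotExp_sub_le (hx : x ∈ Set.Icc 0 1) (hθ : θ ∈ Set.Icc 0 1)
    (he : ∀ k, e (k + 1) ∈ Set.Icc θ D) {n N t : ℕ} (hn : 1 ≤ n) (hNn : N ≤ n)
    (hN : 7 * n ≤ 8 * N) (ht : 8 * t ≤ n) :
    |genCoeff (quotExp x e) N - genCoeff (quotExp x e) (N - t)| ≤
      (16 * D + 8) / n * genReal (quotExp x (e - fun _ => θ)) (radius n) *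
        ∑ i ∈ range t, ratioCoeff x θ i := by
  have hκ := quotExp_mem_Icc (sub_const_mem_Icc hθ.1 he) hx
  have hκ0 := genCoeff_nonneg hκ
  have hD : 0 ≤ D := hθ.1.trans ((he 0).1.trans (he 0).2)
  have hA0 := ratioCoeff_nonneg hx hθ.1
  have hn0 : (0 : ℝ) < n := by exact_mod_cast hn
  have hconv := genCoeff_quotExp_eq_sum_ratioCoeff (.of_mem_Icc he) hx θ
  rw [hconv N, hconv (N - t), ← sum_lagDiff_mul _ _ (by lia : t ≤ N)]
  have hsumA : ∑ i ∈ range (N + 1), |lagDiff (ratioCoeff x θ) t i| ≤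
      2 * ∑ i ∈ range t, ratioCoeff x θ i := by
    rw [show N + 1 = t + (N + 1 - t) by lia]
    exact sum_abs_lagDiff_le hA0 (ratioCoeff_antitone hx hθ) _ _
  have hsumκ : ∑ i ∈ range (N + 1), genCoeff (quotExp x (e - fun _ => θ)) i ≤
      3 * genReal (quotExp x (e - fun _ => θ)) (radius n) :=
    (sum_le_sum_of_subset_of_nonneg (range_subset_range.2 (by lia))
      fun i _ _ => hκ0 i).trans (sum_genCoeff_le hκ hn)
  set K := genReal (quotExp x (e - fun _ => θ)) (radius n)
  set T := ∑ i ∈ range t, ratioCoeff x θ i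
  have hK0 : 0 < K := genReal_pos _ _
  have hT0 : 0 ≤ T := sum_nonneg fun i _ => hA0 i
  have hterm : ∀ i ≤ N, genCoeff (quotExp x (e - fun _ => θ)) (N - i) ≤ 8 * D * K / n ∨
      |lagDiff (ratioCoeff x θ) t i| ≤ 8 / 3 * T / n := fun i _ => by
    rcases le_or_gt (2 * i) n with h | h
    · have hindex : (3 * n : ℝ) ≤ 8 * (N - i : ℕ) := by
        exact_mod_cast (by lia : 3 * n ≤ 8 * (N - i))
      refine .inl ((le_div_iff₀ hn0).2 ?_)
      linarith [mul_genCoeff_le hκ hn (show N - i ≤ n by lia),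
        mul_le_mul_of_nonneg_right hindex (hκ0 (N - i))]
    · have hindex : (3 * n : ℝ) ≤ 8 * ((i - t : ℕ) + 1) := by
        exact_mod_cast (by lia : 3 * n ≤ 8 * (i - t + 1))
      refine .inr ((le_div_iff₀ hn0).2 ?_)
      linarith [abs_lagDiff_ratioCoeff_le hx hθ (show t ≤ i by lia),
        mul_le_mul_of_nonneg_right hindex (abs_nonneg (lagDiff (ratioCoeff x θ) t i))]
  calc _ ≤ _ := abs_sum_mul_le_of_le_or_le hκ0 (by positivity) (by positivity) hterm
    _ ≤ 8 * D * K / n * (2 * T) + 8 / 3 * T / n * (3 * K) := by gcongr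
    _ = (16 * D + 8) / n * K * T := by ring

end Smoothness

section Pointwise

variable {e : ℕ → ℝ} {x θ : ℝ} {n : ℕ}

lemma genReal_quotExp_radius_mul_le {D : ℝ} (he : ∀ k, e (k + 1) ∈ Set.Icc 0 D) (hn : 1 ≤ n)
    (hx : x ∈ Set.Icc 0 (radius n)) :
    genReal (quotExp x e) (radius n) * genReal e x ≤ 2 ^ D * genReal e (radius n) := by
  have hr0 := (radius_pos n).le
  have hr1 := radius_lt_one hn
  have hx1 : x < 1 := hx.2.trans_lt hr1
  have hratio : (1 - x * radius n) / (1 - x) ≤ 2 := by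
    rw [div_le_iff₀ (by linarith)]
    nlinarith [hx.2]
  have hxr : x * radius n ≤ x := mul_le_of_le_one_right hx.1 hr1.le
  have hgrowth : genReal e x ≤ genReal e (x * radius n) * 2 ^ D :=
    calc genReal e x
        ≤ genReal e (x * radius n) * ((1 - x * radius n) / (1 - x)) ^ D :=
          genReal_le_mul_rpow (.of_mem_Icc he) (fun k => (he k).2) (mul_nonneg hx.1 hr0) hxr hx1
      _ ≤ genReal e (x * radius n) * 2 ^ D := by
          gcongr
          · exact (genReal_pos _ _).le
          · exact div_nonneg (by linarith) (by linarith)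
          · exact (he 0).1.trans (he 0).2
  rw [genReal_quotExp (.of_mem_Icc he) ⟨hx.1, hx1.le⟩ hr0 hr1, div_mul_eq_mul_div,
    div_le_iff₀ (genReal_pos _ _)]
  nlinarith [mul_le_mul_of_nonneg_left hgrowth (genReal_pos e (radius n)).le]

lemma rpow_le_genReal_quotExp_const (hθ : 0 ≤ θ) (hn : 1 ≤ n) (hx : x ∈ Set.Icc 0 (radius n)) :
    (n * (1 - x)) ^ θ ≤ genReal (quotExp x fun _ => θ) (radius n) := by
  have hr0 := (radius_pos n).le
  have hr1 := radius_lt_one hn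
  have hx1 : x < 1 := hx.2.trans_lt hr1
  rw [genReal_quotExp (.const θ) ⟨hx.1, hx1.le⟩ hr0 hr1, le_div_iff₀' (genReal_pos _ _)]
  refine le_trans ?_ (mul_rpow_le_genReal (.const θ) (fun _ => le_rfl) (mul_nonneg hx.1 hr0)
    (mul_le_of_le_one_left hr0 hx1.le) hr1)
  have hn0 : (0 : ℝ) < n := by exact_mod_cast hn
  refine mul_le_mul_of_nonneg_left (Real.rpow_le_rpow (mul_nonneg hn0.le (by linarith)) ?_ hθ)
    (genReal_pos _ _).le
  have hgap : n * (1 - radius n) ≤ 1 := by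
    simpa only [mul_one_div_cancel hn0.ne'] using
      mul_le_mul_of_nonneg_left (one_sub_radius_le n) hn0.le
  have hxr : x * radius n ≤ x := mul_le_of_le_one_right hx.1 hr1.le
  rw [le_div_iff₀ (by linarith)]
  nlinarith

lemma genReal_quotExp_sub_const_mul_le {D : ℝ} (hθ : 0 ≤ θ) (he : ∀ k, e (k + 1) ∈ Set.Icc θ D)
    (hn : 1 ≤ n) (hx : x ∈ Set.Icc 0 (radius n)) :
    genReal (quotExp x (e - fun _ => θ)) (radius n) * genReal e x ≤
      2 ^ D * genReal e (radius n) / (n * (1 - x)) ^ θ := by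
  have hr1 := radius_lt_one hn
  have hx1 : x < 1 := hx.2.trans_lt hr1
  have hx01 : x ∈ Set.Icc 0 1 := ⟨hx.1, hx1.le⟩
  have hn0 : (0 : ℝ) < n := by exact_mod_cast hn
  have hbdd := BddExponent.of_mem_Icc he
  rw [le_div_iff₀' (Real.rpow_pos_of_pos (mul_pos hn0 (by linarith)) _), ← mul_assoc]
  calc (n * (1 - x)) ^ θ * genReal (quotExp x (e - fun _ => θ)) (radius n) * genReal e x
      ≤ genReal (quotExp x fun _ => θ) (radius n) *
          genReal (quotExp x (e - fun _ => θ)) (radius n) * genReal e x := by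
        gcongr
        · exact (genReal_pos _ _).le
        · exact (genReal_pos _ _).le
        · exact rpow_le_genReal_quotExp_const hθ hn hx
    _ = genReal (quotExp x e) (radius n) * genReal e x := by
        rw [← genReal_add ((BddExponent.const θ).quotExp hx01)
          ((hbdd.sub (.const θ)).quotExp hx01) (radius_pos n).le hr1,
          quotExp_const_add_quotExp_sub]
    _ ≤ 2 ^ D * genReal e (radius n) :=
        genReal_quotExp_radius_mul_le (fun k => ⟨hθ.trans (he k).1, (he k).2⟩) hn hx

lemma one_sub_mul_sum_add (c : ℕ → ℝ) (x : ℝ) (M : ℕ) :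
    (1 - x) * ∑ m ∈ range M, (∑ i ∈ range m, c i) * x ^ m + (∑ i ∈ range M, c i) * x ^ M =
      x * ∑ m ∈ range M, c m * x ^ m := by
  induction M with
  | zero => simp
  | succ M ih =>
    rw [sum_range_succ _ M, sum_range_succ (fun m => c m * x ^ m), mul_add x, ← ih,
      sum_range_succ c, pow_succ]
    ring

lemma sum_genCoeff_mul_pow_mul_le {D : ℝ} (he : ∀ k, e (k + 1) ∈ Set.Icc 0 D) (hx0 : 0 ≤ x)
    (hx : x < 1) (M : ℕ) :
    ∑ m ∈ range M, genCoeff e m * x ^ m * (1 + m * (1 - x)) ≤ (1 + D) * genReal e x := by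
  have hD : 0 ≤ D := (he 0).1.trans (he 0).2
  have hsum := sum_genCoeff_mul_pow_le he hx0 hx (range M)
  have hpartial : (1 - x) * ∑ m ∈ range M, (∑ i ∈ range m, genCoeff e i) * x ^ m ≤
      genReal e x := by
    have hlast : 0 ≤ (∑ i ∈ range M, genCoeff e i) * x ^ M :=
      mul_nonneg (sum_nonneg fun i _ => genCoeff_nonneg he i) (pow_nonneg hx0 M)
    have hnonneg : 0 ≤ ∑ m ∈ range M, genCoeff e m * x ^ m :=
      sum_nonneg fun i _ => mul_nonneg (genCoeff_nonneg he i) (pow_nonneg hx0 i)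
    linarith [one_sub_mul_sum_add (genCoeff e) x M, mul_le_of_le_one_left hnonneg hx.le]
  calc ∑ m ∈ range M, genCoeff e m * x ^ m * (1 + m * (1 - x))
      ≤ ∑ m ∈ range M, (genCoeff e m * x ^ m +
          D * ((1 - x) * ((∑ i ∈ range m, genCoeff e i) * x ^ m))) := by
        refine sum_le_sum fun m _ => ?_
        have hm := mul_genCoeff_le_sum he fun k (_ : k < m) => (he k).2
        linarith [mul_le_mul_of_nonneg_right hm
          (mul_nonneg (pow_nonneg hx0 m) (sub_nonneg.2 hx.le))]
    _ = ∑ m ∈ range M, genCoeff e m * x ^ m +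
          D * ((1 - x) * ∑ m ∈ range M, (∑ i ∈ range m, genCoeff e i) * x ^ m) := by
        rw [sum_add_distrib, ← mul_sum, ← mul_sum]
    _ ≤ genReal e x + D * genReal e x := by gcongr
    _ = (1 + D) * genReal e x := by ring

lemma one_add_mul_rpow_le {y : ℝ} (hy : 0 ≤ y) (hθ : θ ∈ Set.Icc 0 1) {t j m : ℕ}
    (ht : t ≤ m + j) : (1 + t * y) ^ θ ≤ (1 + j * y) ^ θ * (1 + m * y) := by
  have hmy : 0 ≤ m * y := by positivity
  calc (1 + t * y) ^ θ ≤ ((1 + j * y) * (1 + m * y)) ^ θ := by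
        refine Real.rpow_le_rpow (by positivity) ?_ hθ.1
        have ht' : (t : ℝ) ≤ m + j := by exact_mod_cast ht
        have : 0 ≤ (j * y) * (m * y) := by positivity
        linarith [mul_le_mul_of_nonneg_right ht' hy]
    _ = (1 + j * y) ^ θ * (1 + m * y) ^ θ := Real.mul_rpow (by positivity) (by positivity)
    _ ≤ (1 + j * y) ^ θ * (1 + m * y) := by
        gcongr
        exact Real.rpow_le_self_of_one_le (by linarith) hθ.2

lemma abs_genCoeff_quotExp_lag_le {D : ℝ} (hx : x ∈ Set.Icc 0 1) (hθ : θ ∈ Set.Icc 0 1)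
    (he : ∀ k, e (k + 1) ∈ Set.Icc θ D) {j m : ℕ} (hn : 1 ≤ n) (hj : 8 * j ≤ n)
    (hm : 8 * m ≤ n) :
    |genCoeff (quotExp x e) (n - m) - genCoeff (quotExp x e) (n - j)| ≤
      (16 * D + 8) / n * genReal (quotExp x (e - fun _ => θ)) (radius n) *
        (3 * ((1 + j * (1 - x)) ^ θ * (1 + m * (1 - x)))) := by
  have hy : 0 ≤ 1 - x := sub_nonneg.2 hx.2
  have hD : 0 ≤ D := hθ.1.trans ((he 0).1.trans (he 0).2)
  have hK := genReal_pos (quotExp x (e - fun _ => θ)) (radius n)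
  have hordered : ∀ a b : ℕ, a ≤ b → 8 * b ≤ n → b ≤ m + j →
      |genCoeff (quotExp x e) (n - a) - genCoeff (quotExp x e) (n - b)| ≤
        (16 * D + 8) / n * genReal (quotExp x (e - fun _ => θ)) (radius n) *
          (3 * ((1 + j * (1 - x)) ^ θ * (1 + m * (1 - x)))) := fun a b hab hb hbmj => by
    rcases hab.eq_or_lt with rfl | hlt
    · rw [sub_self, abs_zero]
      positivity
    have hlag := abs_genCoeff_quotExp_sub_le (N := n - a) (t := b - a) hx hθ he hn (by lia)
      (by lia) (by lia)
    rw [show n - a - (b - a) = n - b by lia] at hlag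
    refine hlag.trans ?_
    gcongr
    calc ∑ i ∈ range (b - a), ratioCoeff x θ i ≤ 3 * (1 + (b - a : ℕ) * (1 - x)) ^ θ :=
          sum_genCoeff_quotExp_le (fun _ => ⟨hθ.1, le_rfl⟩) hx (by lia)
      _ ≤ 3 * ((1 + j * (1 - x)) ^ θ * (1 + m * (1 - x))) := by
          gcongr
          exact one_add_mul_rpow_le hy hθ (by lia)
  rcases le_total m j with h | h
  · exact hordered m j h hj (by lia)
  · rw [abs_sub_comm]
    exact hordered j m h hm (by lia)

lemma exists_rpow_mul_pow_mul_exp_le (D : ℕ) : ∃ C > 0, ∀ θ ∈ Set.Icc (0 : ℝ) 1, ∀ u ≥ 0,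
    u ^ θ * ((1 + u) ^ D * Real.exp (-u / 16)) ≤ C := by
  refine ⟨Real.exp (1 / 16) * 16 ^ (D + 1) * (D + 1).factorial, by positivity,
    fun θ hθ u hu => ?_⟩
  have hpow : u ^ θ ≤ 1 + u :=
    (Real.rpow_le_rpow hu (by linarith) hθ.1).trans
      (Real.rpow_le_self_of_one_le (by linarith) hθ.2)
  have hexp := Real.pow_div_factorial_le_exp ((1 + u) / 16) (by positivity) (D + 1)
  rw [div_le_iff₀ (by positivity), div_pow, div_le_iff₀ (by positivity)] at hexp
  have hcancel : Real.exp ((1 + u) / 16) * Real.exp (-u / 16) = Real.exp (1 / 16) := by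
    rw [← Real.exp_add]
    congr 1
    ring
  calc u ^ θ * ((1 + u) ^ D * Real.exp (-u / 16))
      ≤ (1 + u) * ((1 + u) ^ D * Real.exp (-u / 16)) := by gcongr
    _ = (1 + u) ^ (D + 1) * Real.exp (-u / 16) := by ring
    _ ≤ Real.exp ((1 + u) / 16) * (D + 1).factorial * 16 ^ (D + 1) * Real.exp (-u / 16) := by
        gcongr
    _ = Real.exp (1 / 16) * 16 ^ (D + 1) * (D + 1).factorial := by rw [← hcancel]; ring

lemma sqrt_pow_le_exp (hx : x ≤ 1) {M : ℕ} (hM : n ≤ 8 * M) :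
    √x ^ M ≤ Real.exp (-(n * (1 - x)) / 16) := by
  have hsqrt : √x ≤ Real.exp ((x - 1) / 2) := by
    rw [Real.exp_half]
    exact Real.sqrt_le_sqrt (by linarith [Real.add_one_le_exp (x - 1)])
  calc √x ^ M ≤ Real.exp ((x - 1) / 2) ^ M := by gcongr
    _ = Real.exp (M * ((x - 1) / 2)) := by rw [← Real.exp_nat_mul]
    _ ≤ Real.exp (-(n * (1 - x)) / 16) := by
      have hM' : (n : ℝ) ≤ 8 * M := by exact_mod_cast hM
      exact Real.exp_le_exp.2 (by linarith [mul_le_mul_of_nonneg_right hM' (sub_nonneg.2 hx)])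

lemma pow_le_exp (hx : x ∈ Set.Icc 0 1) {m : ℕ} (hm : n ≤ 8 * m) :
    x ^ m ≤ Real.exp (-(n * (1 - x)) / 16) :=
  (pow_le_pow_left₀ hx.1 (Real.le_sqrt_of_sq_le (pow_le_of_le_one hx.1 hx.2 two_ne_zero)) m).trans
    (sqrt_pow_le_exp hx.2 hm)

lemma genCoeff_sub_mul_genCoeff_quotExp (he : BddExponent e) (hx : x ∈ Set.Icc 0 1) {M : ℕ}
    (hM : M ≤ n + 1) (P q : ℝ) : genCoeff e n - P * q =
      ∑ m ∈ range M, genCoeff e m * x ^ m * (genCoeff (quotExp x e) (n - m) - q) +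
      ∑ i ∈ range (n + 1 - M),
        genCoeff e (M + i) * x ^ (M + i) * genCoeff (quotExp x e) (n - (M + i)) -
      (P - ∑ m ∈ range M, genCoeff e m * x ^ m) * q := by
  rw [genCoeff_eq_sum_quotExp he hx n, ← Nat.add_sub_cancel' hM, sum_range_add,
    Nat.add_sub_cancel_left]
  simp only [mul_sub, sum_sub_distrib, ← sum_mul, mul_comm (x ^ _)]
  ring

lemma abs_sum_mul_genCoeff_sub_le {D : ℝ} (hθ : θ ∈ Set.Icc 0 1)
    (he : ∀ k, e (k + 1) ∈ Set.Icc θ D) (hn : 1 ≤ n) {j M : ℕ} (hj : 8 * j ≤ n)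
    (hM : 8 * M ≤ n + 8) (hx : x ∈ Set.Icc 0 (radius n)) :
    |∑ m ∈ range M, genCoeff e m * x ^ m *
        (genCoeff (quotExp x e) (n - m) - genCoeff (quotExp x e) (n - j))| ≤
      (16 * D + 8) * 3 * (1 + D) * 2 ^ D * (genReal e (radius n) / n) *
        ((1 + j * (1 - x)) ^ θ / (n * (1 - x)) ^ θ) := by
  have hx1 : x < 1 := hx.2.trans_lt (radius_lt_one hn)
  have he0 : ∀ k, e (k + 1) ∈ Set.Icc 0 D := fun k => ⟨hθ.1.trans (he k).1, (he k).2⟩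
  have hD : 0 ≤ D := (he0 0).1.trans (he0 0).2
  set K := genReal (quotExp x (e - fun _ => θ)) (radius n)
  have hK : 0 < K := genReal_pos _ _
  have : 0 ≤ (1 + j * (1 - x)) ^ θ :=
    Real.rpow_nonneg (by linarith [mul_nonneg j.cast_nonneg (sub_nonneg.2 hx1.le)]) _
  have hterm : ∀ m ∈ range M, |genCoeff e m * x ^ m *
      (genCoeff (quotExp x e) (n - m) - genCoeff (quotExp x e) (n - j))| ≤
      (16 * D + 8) / n * K * 3 * (1 + j * (1 - x)) ^ θ *
        (genCoeff e m * x ^ m * (1 + m * (1 - x))) := fun m hm => by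
    have hpm : 0 ≤ genCoeff e m * x ^ m := mul_nonneg (genCoeff_nonneg he0 m) (pow_nonneg hx.1 m)
    have hlag := abs_genCoeff_quotExp_lag_le ⟨hx.1, hx1.le⟩ hθ he hn hj
      (show 8 * m ≤ n by have := mem_range.1 hm; lia)
    rw [abs_mul, abs_of_nonneg hpm]
    exact (mul_le_mul_of_nonneg_left hlag hpm).trans_eq (by ring)
  calc _ ≤ _ := (abs_sum_le_sum_abs _ _).trans (sum_le_sum hterm)
    _ ≤ (16 * D + 8) / n * K * 3 * (1 + j * (1 - x)) ^ θ * ((1 + D) * genReal e x) := by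
      rw [← mul_sum]
      gcongr
      exact sum_genCoeff_mul_pow_mul_le he0 hx.1 hx1 M
    _ = (16 * D + 8) / n * 3 * (1 + j * (1 - x)) ^ θ * (1 + D) * (K * genReal e x) := by ring
    _ ≤ (16 * D + 8) / n * 3 * (1 + j * (1 - x)) ^ θ * (1 + D) *
          (2 ^ D * genReal e (radius n) / (n * (1 - x)) ^ θ) := by
      gcongr
      exact genReal_quotExp_sub_const_mul_le hθ.1 he hn hx
    _ = _ := by ring

lemma sum_genCoeff_mul_genCoeff_quotExp_le {D : ℝ} (he : ∀ k, e (k + 1) ∈ Set.Icc 0 D)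
    (hn : 1 ≤ n) {M : ℕ} (hM : n ≤ 8 * M) (hx : x ∈ Set.Icc 0 1) :
    ∑ i ∈ range (n + 1 - M),
        genCoeff e (M + i) * x ^ (M + i) * genCoeff (quotExp x e) (n - (M + i)) ≤
      72 * D * (genReal e (radius n) / n) *
        (genReal (quotExp x e) (radius n) * Real.exp (-(n * (1 - x)) / 16)) := by
  have hq := quotExp_mem_Icc he hx
  have hD : 0 ≤ D := (he 0).1.trans (he 0).2
  have hn0 : (0 : ℝ) < n := by exact_mod_cast hn
  set R := genReal e (radius n)
  have hR : 0 < R := genReal_pos _ _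
  have hterm : ∀ i ∈ range (n + 1 - M),
      genCoeff e (M + i) * x ^ (M + i) * genCoeff (quotExp x e) (n - (M + i)) ≤
        24 * D * R / n * Real.exp (-(n * (1 - x)) / 16) *
          genCoeff (quotExp x e) (n + 1 - M - 1 - i) := fun i hi => by
    have hindex : (n : ℝ) ≤ 8 * (M + i : ℕ) := by exact_mod_cast (by lia : n ≤ 8 * (M + i))
    have hcoeff : genCoeff e (M + i) ≤ 24 * D * R / n := by
      rw [le_div_iff₀ hn0]
      linarith [mul_le_mul_of_nonneg_right hindex (genCoeff_nonneg he (M + i)),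
        mul_genCoeff_le he hn (show M + i ≤ n by have := mem_range.1 hi; lia)]
    rw [show n - (M + i) = n + 1 - M - 1 - i by lia]
    gcongr
    · exact genCoeff_nonneg hq _
    · exact pow_nonneg hx.1 _
    · exact pow_le_exp hx (by lia)
  have hsum : ∑ i ∈ range (n + 1 - M), genCoeff (quotExp x e) (n + 1 - M - 1 - i) ≤
      3 * genReal (quotExp x e) (radius n) := by
    rw [sum_range_reflect (genCoeff (quotExp x e))]
    exact (sum_le_sum_of_subset_of_nonneg (range_subset_range.2 (by lia))
      fun i _ _ => genCoeff_nonneg hq i).trans (sum_genCoeff_le hq hn)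
  calc _ ≤ _ := sum_le_sum hterm
    _ ≤ 24 * D * R / n * Real.exp (-(n * (1 - x)) / 16) *
          (3 * genReal (quotExp x e) (radius n)) := by
        rw [← mul_sum]
        gcongr
    _ = _ := by ring

lemma genReal_sub_sum_mul_genCoeff_quotExp_le {D : ℕ} (he : ∀ k, e (k + 1) ∈ Set.Icc (0 : ℝ) D)
    (hn : 1 ≤ n) {j M : ℕ} (hj : 8 * j ≤ n) (hM : n ≤ 8 * M) (hx : x ∈ Set.Icc 0 (radius n)) :
    (genReal e x - ∑ m ∈ range M, genCoeff e m * x ^ m) * genCoeff (quotExp x e) (n - j) ≤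
      6 * D * 2 ^ D * (genReal e (radius n) / n) *
        (genReal (quotExp x e) (radius n) * Real.exp (-(n * (1 - x)) / 16)) := by
  have hr1 := radius_lt_one hn
  have hx1 : x < 1 := hx.2.trans_lt hr1
  have hq := quotExp_mem_Icc he ⟨hx.1, hx1.le⟩
  have hn0 : (0 : ℝ) < n := by exact_mod_cast hn
  set ε := Real.exp (-(n * (1 - x)) / 16)
  set H := genReal (quotExp x e) (radius n)
  have : 0 < H := genReal_pos _ _
  have htail : genReal e x - ∑ m ∈ range M, genCoeff e m * x ^ m ≤
      2 ^ D * ε * genReal e (radius n) := by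
    have hsq := genReal_sq_sub_sum_le he (Real.sqrt_nonneg x)
      ((Real.sqrt_lt' one_pos).2 (by simpa using hx1)) M
    rw [Real.sq_sqrt hx.1] at hsq
    refine hsq.trans ?_
    gcongr
    · exact (genReal_pos _ _).le
    · exact sqrt_pow_le_exp hx1.le hM
    · exact genReal_mono he hx.1 hx.2 hr1
  have hcoeff : genCoeff (quotExp x e) (n - j) ≤ 6 * D * H / n := by
    have hindex : (n : ℝ) ≤ 2 * (n - j : ℕ) := by exact_mod_cast (by lia : n ≤ 2 * (n - j))
    rw [le_div_iff₀ hn0]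
    linarith [mul_genCoeff_le hq hn (Nat.sub_le n j),
      mul_le_mul_of_nonneg_right hindex (genCoeff_nonneg hq (n - j))]
  calc _ ≤ 2 ^ D * ε * genReal e (radius n) * (6 * D * H / n) := by
        have := genReal_pos e (radius n)
        exact mul_le_mul htail hcoeff (genCoeff_nonneg hq _) (by positivity)
    _ = _ := by ring

lemma exists_genReal_quotExp_mul_exp_le (D : ℕ) : ∃ C > 0, ∀ e : ℕ → ℝ,
    (∀ k, e (k + 1) ∈ Set.Icc (0 : ℝ) D) → ∀ θ ∈ Set.Icc (0 : ℝ) 1, ∀ n ≥ 1,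
    ∀ x ∈ Set.Ico (0 : ℝ) 1,
    genReal (quotExp x e) (radius n) * Real.exp (-(n * (1 - x)) / 16) ≤
      C / (n * (1 - x)) ^ θ := by
  obtain ⟨C, hC0, hC⟩ := exists_rpow_mul_pow_mul_exp_le D
  refine ⟨C, hC0, fun e he θ hθ n hn x hx => ?_⟩
  have hn0 : (0 : ℝ) < n := by exact_mod_cast hn
  have hu : 0 < n * (1 - x) := mul_pos hn0 (sub_pos.2 hx.2)
  rw [le_div_iff₀' (Real.rpow_pos_of_pos hu θ)]
  refine le_trans ?_ (hC θ hθ _ hu.le)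
  gcongr
  simpa only [Real.rpow_natCast] using genReal_quotExp_radius_le he ⟨hx.1, hx.2.le⟩ hn

-- Splitting `p_n = ∑ m, p_m x ^ m h_{n-m}` at `n / 8`, where `h = p / p(x ·)`: for small `m` the
-- coefficient `h_{n-m}` is close to `h_{n-j}`; both tails are exponentially small in `n (1 - x)`.
lemma exists_abs_genCoeff_sub_le (D : ℕ) : ∃ C > 0, ∀ θ ∈ Set.Icc (0 : ℝ) 1, ∀ e : ℕ → ℝ,
    (∀ k, e (k + 1) ∈ Set.Icc θ D) → ∀ n j : ℕ, 1 ≤ n → 8 * j ≤ n →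
    ∀ x ∈ Set.Icc 0 (radius n),
    |genCoeff e n - genReal e x * genCoeff (quotExp x e) (n - j)| ≤
      C * (genReal e (radius n) / n) * ((1 + j * (1 - x)) ^ θ / (n * (1 - x)) ^ θ) := by
  obtain ⟨C, hC0, hC⟩ := exists_genReal_quotExp_mul_exp_le D
  refine ⟨(16 * D + 8) * 3 * (1 + D) * 2 ^ D + (72 * D + 6 * D * 2 ^ D) * C, by positivity,
    fun θ hθ e he n j hn hj x hx => ?_⟩
  have he0 : ∀ k, e (k + 1) ∈ Set.Icc (0 : ℝ) D := fun k => ⟨hθ.1.trans (he k).1, (he k).2⟩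
  have hx1 : x < 1 := hx.2.trans_lt (radius_lt_one hn)
  have hx01 : x ∈ Set.Icc 0 1 := ⟨hx.1, hx1.le⟩
  have hq0 := genCoeff_nonneg (quotExp_mem_Icc he0 hx01)
  have hhead := abs_sum_mul_genCoeff_sub_le hθ he hn hj (M := n / 8 + 1) (by lia) hx
  have hmiddle := sum_genCoeff_mul_genCoeff_quotExp_le he0 hn (M := n / 8 + 1) (by lia) hx01
  have htail := genReal_sub_sum_mul_genCoeff_quotExp_le he0 hn hj (M := n / 8 + 1) (by lia) hx
  rw [Real.rpow_natCast] at hhead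
  rw [← abs_of_nonneg (sum_nonneg fun i _ => mul_nonneg (mul_nonneg (genCoeff_nonneg he0 _)
    (pow_nonneg hx.1 _)) (hq0 _))] at hmiddle
  rw [← abs_of_nonneg (mul_nonneg (sub_nonneg.2 (sum_genCoeff_mul_pow_le he0 hx.1 hx1 _))
    (hq0 _))] at htail
  rw [genCoeff_sub_mul_genCoeff_quotExp (.of_mem_Icc he) hx01 (by lia : n / 8 + 1 ≤ n + 1)]
  set R := genReal e (radius n)
  set J := (1 + j * (1 - x)) ^ θ
  set U := (n * (1 - x)) ^ θ
  have hdecay : genReal (quotExp x e) (radius n) * Real.exp (-(n * (1 - x)) / 16) ≤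
      C * (J / U) := by
    refine (hC e he0 θ hθ n hn x ⟨hx.1, hx1⟩).trans ?_
    have hy : 0 ≤ 1 - x := sub_nonneg.2 hx1.le
    have hJ : 1 ≤ J := Real.one_le_rpow (by linarith [mul_nonneg j.cast_nonneg hy]) hθ.1
    rw [← mul_div_assoc]
    gcongr
    exact le_mul_of_one_le_right hC0.le hJ
  have hR : 0 < R := genReal_pos _ _
  refine (abs_sub _ _).trans ((add_le_add (abs_add_le _ _) le_rfl).trans
    ((add_le_add (add_le_add hhead hmiddle) htail).trans ?_))
  calc _ ≤ (16 * D + 8) * 3 * (1 + D) * 2 ^ D * (R / n) * (J / U) +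
        72 * D * (R / n) * (C * (J / U)) + 6 * D * 2 ^ D * (R / n) * (C * (J / U)) := by gcongr
    _ = _ := by ring

end Pointwise

section BetaIntegrals

lemma integral_pow_mul_one_sub_pow_succ (i a : ℕ) :
    ((i : ℝ) + 1) * ∫ x in (0 : ℝ)..1, x ^ i * (1 - x) ^ (a + 1) =
      ((a : ℝ) + 1) * ∫ x in (0 : ℝ)..1, x ^ (i + 1) * (1 - x) ^ a := by
  have hderiv : ∀ x ∈ Set.uIcc (0 : ℝ) 1, HasDerivAt (fun x : ℝ => x ^ (i + 1) * (1 - x) ^ (a + 1))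
      (((i : ℝ) + 1) * (x ^ i * (1 - x) ^ (a + 1)) - ((a : ℝ) + 1) * (x ^ (i + 1) * (1 - x) ^ a))
      x := by
    intro x _
    refine ((hasDerivAt_pow (i + 1) x).mul
      (((hasDerivAt_id x).const_sub 1).pow (a + 1))).congr_deriv ?_
    simp only [id, Nat.add_sub_cancel, Pi.pow_apply]
    push_cast
    ring
  have hint := intervalIntegral.integral_eq_sub_of_hasDerivAt hderiv
    (Continuous.intervalIntegrable (by fun_prop) _ _)
  rw [intervalIntegral.integral_sub (Continuous.intervalIntegrable (by fun_prop) _ _)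
    (Continuous.intervalIntegrable (by fun_prop) _ _), intervalIntegral.integral_const_mul,
    intervalIntegral.integral_const_mul, sub_self, zero_pow (Nat.succ_ne_zero _),
    zero_pow (Nat.succ_ne_zero _), mul_zero, zero_mul, sub_self] at hint
  exact sub_eq_zero.1 hint

lemma integral_pow_mul_one_sub_pow_le (i a : ℕ) :
    ∫ x in (0 : ℝ)..1, x ^ i * (1 - x) ^ a ≤ a.factorial / ((i : ℝ) + 1) ^ (a + 1) := by
  induction a with
  | zero => simp [integral_pow]
  | succ a ih =>
    have hmono : ∫ x in (0 : ℝ)..1, x ^ (i + 1) * (1 - x) ^ a ≤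
        ∫ x in (0 : ℝ)..1, x ^ i * (1 - x) ^ a := by
      refine intervalIntegral.integral_mono_on zero_le_one
        (Continuous.intervalIntegrable (by fun_prop) _ _)
        (Continuous.intervalIntegrable (by fun_prop) _ _) fun x hx => ?_
      exact mul_le_mul_of_nonneg_right (pow_le_pow_of_le_one hx.1 hx.2 (Nat.le_succ i))
        (pow_nonneg (sub_nonneg.2 hx.2) a)
    refine le_of_mul_le_mul_left ?_ (by positivity : (0 : ℝ) < (i : ℝ) + 1)
    calc _ = ((a : ℝ) + 1) * ∫ x in (0 : ℝ)..1, x ^ (i + 1) * (1 - x) ^ a :=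
          integral_pow_mul_one_sub_pow_succ i a
      _ ≤ ((a : ℝ) + 1) * (a.factorial / ((i : ℝ) + 1) ^ (a + 1)) := by
          gcongr
          exact hmono.trans ih
      _ = _ := by
          rw [Nat.factorial_succ, pow_succ _ (a + 1)]
          push_cast
          field_simp

lemma integral_pow_mul_one_sub_pow_mul_one_add_pow_le (D b : ℕ) {c : ℝ} (hc : 0 ≤ c) {j : ℕ}
    (hj : 1 ≤ j) :
    ∫ x in (0 : ℝ)..1, x ^ (j - 1) * ((1 - x) ^ b * (1 + c * j * (1 - x)) ^ D) ≤
      2 ^ D * (b.factorial + c ^ D * (b + D).factorial) / (j : ℝ) ^ (b + 1) := by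
  obtain ⟨i, rfl⟩ := Nat.exists_eq_add_of_le' hj
  rw [Nat.add_sub_cancel, Nat.cast_succ]
  calc ∫ x in (0 : ℝ)..1, x ^ i * ((1 - x) ^ b * (1 + c * (i + 1) * (1 - x)) ^ D)
      ≤ ∫ x in (0 : ℝ)..1, (2 ^ D * (x ^ i * (1 - x) ^ b) +
          2 ^ D * (c * (i + 1)) ^ D * (x ^ i * (1 - x) ^ (b + D))) := by
        refine intervalIntegral.integral_mono_on zero_le_one
          (Continuous.intervalIntegrable (by fun_prop) _ _)
          (Continuous.intervalIntegrable (by fun_prop) _ _) fun x hx => ?_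
        have hx0 : 0 ≤ x := hx.1
        have hy : 0 ≤ 1 - x := sub_nonneg.2 hx.2
        have hpow : (1 + c * (i + 1) * (1 - x)) ^ D ≤
            2 ^ D * (1 + (c * (i + 1) * (1 - x)) ^ D) := by
          refine (add_pow_le zero_le_one (by positivity) D).trans ?_
          rw [one_pow]
          gcongr
          · exact one_le_two
          · exact D.sub_le 1
        calc _ = (x ^ i * (1 - x) ^ b) * (1 + c * (i + 1) * (1 - x)) ^ D := by ring
          _ ≤ (x ^ i * (1 - x) ^ b) * (2 ^ D * (1 + (c * (i + 1) * (1 - x)) ^ D)) := by gcongr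
          _ = _ := by rw [mul_pow _ (1 - x), pow_add]; ring
    _ = 2 ^ D * (∫ x in (0 : ℝ)..1, x ^ i * (1 - x) ^ b) +
          2 ^ D * (c * (i + 1)) ^ D * ∫ x in (0 : ℝ)..1, x ^ i * (1 - x) ^ (b + D) := by
        rw [intervalIntegral.integral_add (Continuous.intervalIntegrable (by fun_prop) _ _)
          (Continuous.intervalIntegrable (by fun_prop) _ _), intervalIntegral.integral_const_mul,
          intervalIntegral.integral_const_mul]
    _ ≤ 2 ^ D * (b.factorial / ((i : ℝ) + 1) ^ (b + 1)) +
          2 ^ D * (c * (i + 1)) ^ D * ((b + D).factorial / ((i : ℝ) + 1) ^ (b + D + 1)) := by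
        gcongr <;> exact integral_pow_mul_one_sub_pow_le _ _
    _ = _ := by
        rw [mul_pow, add_right_comm b D 1, pow_add _ (b + 1) D]
        field_simp

lemma integral_pow_mul_one_add_pow_le (D : ℕ) {r : ℝ} (hr : r ∈ Set.Icc 0 1) {j : ℕ}
    (hj : 1 ≤ j) :
    ∫ x in (0 : ℝ)..r, x ^ (j - 1) * (1 + j * (1 - x)) ^ D ≤ 2 ^ D * (1 + D.factorial) / j := by
  have hone := integral_pow_mul_one_sub_pow_mul_one_add_pow_le D 0 (zero_le_one (α := ℝ)) hj
  simp only [pow_zero, one_mul, Nat.factorial_zero, Nat.cast_one, one_pow, zero_add,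
    pow_one] at hone
  refine le_trans (intervalIntegral.integral_mono_interval le_rfl hr.1 hr.2 ?_
    (Continuous.intervalIntegrable (by fun_prop) _ _)) hone
  refine (MeasureTheory.ae_restrict_mem measurableSet_Ioc).mono fun x hx => ?_
  exact mul_nonneg (pow_nonneg hx.1.le _)
    (pow_nonneg (add_nonneg zero_le_one (mul_nonneg j.cast_nonneg (sub_nonneg.2 hx.2))) _)

lemma integral_pow_div_le {D : ℕ} {f : ℝ → ℝ} {r K : ℝ} (hr : r ∈ Set.Icc 0 1) (hK : 0 < K)
    {j : ℕ} (hj : 1 ≤ j) (hf : ContinuousOn f (Set.Icc 0 r)) (hf0 : ∀ x ∈ Set.Icc 0 r, 0 < f x)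
    (hKf : ∀ x ∈ Set.Icc 0 r, K ≤ (1 + j * (1 - x)) ^ D * f x) :
    ∫ x in (0 : ℝ)..r, x ^ (j - 1) / f x ≤ 2 ^ D * (1 + D.factorial) / (j * K) := by
  calc ∫ x in (0 : ℝ)..r, x ^ (j - 1) / f x
      ≤ ∫ x in (0 : ℝ)..r, K⁻¹ * (x ^ (j - 1) * (1 + j * (1 - x)) ^ D) := by
        refine intervalIntegral.integral_mono_on hr.1 (ContinuousOn.intervalIntegrable ?_)
          (Continuous.intervalIntegrable (by fun_prop) _ _) fun x hx => ?_
        · rw [Set.uIcc_of_le hr.1]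
          exact ContinuousOn.div (by fun_prop) hf fun x hx => (hf0 x hx).ne'
        · rw [div_le_iff₀ (hf0 x hx), inv_mul_eq_div, div_mul_eq_mul_div, le_div_iff₀ hK, mul_assoc]
          exact mul_le_mul_of_nonneg_left (hKf x hx) (pow_nonneg hx.1 _)
    _ = K⁻¹ * ∫ x in (0 : ℝ)..r, x ^ (j - 1) * (1 + j * (1 - x)) ^ D :=
        intervalIntegral.integral_const_mul _ _
    _ ≤ K⁻¹ * (2 ^ D * (1 + D.factorial) / j) := by
        gcongr
        exact integral_pow_mul_one_add_pow_le D hr hj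
    _ = _ := by field_simp

end BetaIntegrals

/-- The weight `∫_0^{r_n} x ^ (j - 1) / p(x) dx`, where `r_n = e^{-1/n}`, with which `S(g; j)`
contributes to the Abel value `g(r_n)`. -/
noncomputable def abelWeight (e : ℕ → ℝ) (n j : ℕ) : ℝ :=
  ∫ x in (0 : ℝ)..radius n, x ^ (j - 1) / genReal e x

section AbelWeight

variable {e : ℕ → ℝ} {D n j : ℕ} {x θ : ℝ}

lemma continuousOn_genReal (he : BddExponent e) : ContinuousOn (genReal e) (Set.Ico 0 1) := by
  have hre : genReal e = fun x : ℝ => (genFun e (x : ℂ)).re :=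
    funext fun x => by rw [genFun_ofReal, Complex.ofReal_re]
  rw [hre]
  refine Complex.continuous_re.comp_continuousOn
    ((differentiableOn_genFun he).continuousOn.comp Complex.continuous_ofReal.continuousOn ?_)
  intro x hx
  simpa [abs_of_nonneg hx.1] using hx.2

lemma intervalIntegrable_pow_div_genReal (he : BddExponent e) (hn : 1 ≤ n) (j : ℕ) :
    IntervalIntegrable (fun x => x ^ (j - 1) / genReal e x) MeasureTheory.volume 0 (radius n) := by
  refine ContinuousOn.intervalIntegrable ?_
  rw [Set.uIcc_of_le (radius_pos n).le]
  exact ContinuousOn.div (by fun_prop) ((continuousOn_genReal he).mono fun x hx =>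
    ⟨hx.1, hx.2.trans_lt (radius_lt_one hn)⟩) fun x _ => (genReal_pos e x).ne'

lemma abelWeight_nonneg (e : ℕ → ℝ) (n j : ℕ) : 0 ≤ abelWeight e n j :=
  intervalIntegral.integral_nonneg (radius_pos n).le fun x hx =>
    div_nonneg (pow_nonneg hx.1 _) (genReal_pos e x).le

lemma genReal_radius_mul_rpow_le_of_le (hθ : θ ≤ 1) (he : BddExponent e)
    (hD : ∀ k, e (k + 1) ≤ D) (hj : 1 ≤ j) (hx : x ∈ Set.Icc 0 (radius j)) :
    genReal e (radius j) * ((1 + j * (1 - x)) / (j * (1 - x))) ^ θ ≤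
      3 * 2 ^ D * (1 + j * (1 - x)) ^ D * genReal e x := by
  have hr := one_div_le_one_sub_radius hj
  have hr1 := radius_lt_one hj
  have : (0 : ℝ) < j := by exact_mod_cast hj
  have hy : 0 ≤ 1 - x := by linarith [hx.2]
  have hratio : (1 - x) / (1 - radius j) ≤ 2 * (1 + j * (1 - x)) := by
    rw [div_le_iff₀ (sub_pos.2 hr1)]
    calc 1 - x ≤ 2 * (1 + j * (1 - x)) * (1 / (2 * j)) := by
          rw [mul_one_div, le_div_iff₀ (by positivity)]; linarith
      _ ≤ _ := by gcongr
  have hu : 1 / 2 ≤ j * (1 - x) := by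
    calc (1 / 2 : ℝ) = j * (1 / (2 * j)) := by field_simp
      _ ≤ j * (1 - x) := by gcongr; linarith [hx.2]
  have hrpow : ((1 + j * (1 - x)) / (j * (1 - x))) ^ θ ≤ 3 := by
    refine (Real.rpow_le_rpow_of_exponent_le ?_ hθ).trans ?_
    · rw [le_div_iff₀ (by linarith)]; linarith
    · rw [Real.rpow_one, div_le_iff₀ (by linarith)]; linarith
  calc _ ≤ genReal e x * (2 * (1 + j * (1 - x))) ^ D * 3 := by
        gcongr
        · exact mul_nonneg (genReal_pos _ _).le (by positivity)
        · refine (genReal_le_mul_rpow he hD hx.1 hx.2 hr1).trans ?_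
          rw [Real.rpow_natCast]
          have : 0 ≤ (1 - x) / (1 - radius j) := div_nonneg hy (sub_pos.2 hr1).le
          gcongr
          exact (genReal_pos _ _).le
    _ = _ := by rw [mul_pow]; ring

lemma genReal_radius_mul_rpow_le_of_ge (hθ : 0 ≤ θ) (he : ∀ k, e (k + 1) ∈ Set.Icc θ D)
    (hj : 1 ≤ j) (hx : x ∈ Set.Ico (radius j) 1) :
    genReal e (radius j) * ((1 + j * (1 - x)) / (j * (1 - x))) ^ θ ≤
      2 ^ D * (1 + j * (1 - x)) ^ D * genReal e x := by
  have hr1 := radius_lt_one hj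
  have : (0 : ℝ) < j := by exact_mod_cast hj
  have hy : 0 < 1 - x := sub_pos.2 hx.2
  have hu : 0 < j * (1 - x) := by positivity
  have : 0 < 1 - radius j := sub_pos.2 hr1
  have hratio : (1 + j * (1 - x)) / (j * (1 - x)) ≤
      2 * (1 + j * (1 - x)) * ((1 - radius j) / (1 - x)) := by
    calc _ = 2 * (1 + j * (1 - x)) * (1 / (2 * j) / (1 - x)) := by field_simp
      _ ≤ _ := by
        gcongr
        exact one_div_le_one_sub_radius hj
  calc _ ≤ genReal e (radius j) * (2 * (1 + j * (1 - x)) * ((1 - radius j) / (1 - x))) ^ θ := by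
        gcongr
        exact (genReal_pos _ _).le
    _ = (2 * (1 + j * (1 - x))) ^ θ *
        (genReal e (radius j) * ((1 - radius j) / (1 - x)) ^ θ) := by
        rw [Real.mul_rpow (by positivity) (by positivity)]; ring
    _ ≤ (2 * (1 + j * (1 - x))) ^ D * genReal e x := by
        refine mul_le_mul ?_ (mul_rpow_le_genReal (.of_mem_Icc he) (fun k => (he k).1)
          (radius_pos j).le hx.1 hx.2) (mul_nonneg (genReal_pos _ _).le (by positivity))
          (by positivity)
        rw [← Real.rpow_natCast]
        exact Real.rpow_le_rpow_of_exponent_le (by linarith) ((he 0).1.trans (he 0).2)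
    _ = _ := by rw [mul_pow]

lemma genReal_radius_mul_rpow_le (hθ : θ ∈ Set.Icc 0 1) (he : ∀ k, e (k + 1) ∈ Set.Icc θ D)
    (hj : 1 ≤ j) (hx : x ∈ Set.Ico 0 1) :
    genReal e (radius j) * ((1 + j * (1 - x)) / (j * (1 - x))) ^ θ ≤
      3 * 2 ^ D * (1 + j * (1 - x)) ^ D * genReal e x := by
  rcases le_total x (radius j) with hxr | hrx
  · exact genReal_radius_mul_rpow_le_of_le hθ.2 (.of_mem_Icc he) (fun k => (he k).2) hj ⟨hx.1, hxr⟩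
  · refine (genReal_radius_mul_rpow_le_of_ge hθ.1 he hj ⟨hrx, hx.2⟩).trans ?_
    have := genReal_pos e x
    have : 0 ≤ 1 - x := sub_nonneg.2 hx.2.le
    gcongr
    linarith [pow_pos (zero_lt_two (α := ℝ)) D]

lemma genReal_radius_le_mul_genReal (he : ∀ k, e (k + 1) ∈ Set.Icc (0 : ℝ) D)
    (hj : 1 ≤ j) (hx : x ∈ Set.Ico 0 1) :
    genReal e (radius j) ≤ 3 * 2 ^ D * (1 + j * (1 - x)) ^ D * genReal e x := by
  simpa only [Real.rpow_zero, mul_one] using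
    genReal_radius_mul_rpow_le ⟨le_rfl, zero_le_one⟩ he hj hx

lemma abelWeight_le (he : ∀ k, e (k + 1) ∈ Set.Icc (0 : ℝ) D) (hn : 1 ≤ n) (hj : 1 ≤ j) :
    abelWeight e n j ≤
      3 * 2 ^ D * (2 ^ D * (1 + D.factorial)) / (j * genReal e (radius j)) := by
  have hr1 := radius_lt_one hn
  have hG := genReal_pos e (radius j)
  refine (integral_pow_div_le (D := D) (K := genReal e (radius j) / (3 * 2 ^ D))
    ⟨(radius_pos n).le, hr1.le⟩ (by positivity) hj
    ((continuousOn_genReal (.of_mem_Icc he)).mono fun x hx => ⟨hx.1, hx.2.trans_lt hr1⟩)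
    (fun x _ => genReal_pos e x) fun x hx => ?_).trans_eq (by field_simp)
  rw [div_le_iff₀ (by positivity)]
  linarith [genReal_radius_le_mul_genReal he hj ⟨hx.1, hx.2.trans_lt hr1⟩]

lemma genReal_radius_le_mul_genReal_mul (he : ∀ k, e (k + 1) ∈ Set.Icc (0 : ℝ) D) (hn : 1 ≤ n)
    (hx : x ∈ Set.Icc 0 1) :
    genReal e (radius n) ≤ (1 + n * (1 - x)) ^ D * genReal e (radius n * x) := by
  have hquot := genReal_quotExp_radius_le he hx hn
  rwa [genReal_quotExp (.of_mem_Icc he) hx (radius_pos n).le (radius_lt_one hn),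
    div_le_iff₀ (genReal_pos _ _), Real.rpow_natCast, mul_comm x] at hquot

-- The substitution `x = r_n s` brings out the factor `r_n ^ j`.
lemma abelWeight_le_of_le (he : ∀ k, e (k + 1) ∈ Set.Icc (0 : ℝ) D) (hn : 1 ≤ n) (hnj : n ≤ j) :
    abelWeight e n j ≤
      2 ^ D * (1 + D.factorial) * (radius n ^ j / (j * genReal e (radius n))) := by
  have hr0 := radius_pos n
  have hr1 := radius_lt_one hn
  have hsubst : abelWeight e n j =
      radius n ^ j * ∫ s in (0 : ℝ)..1, s ^ (j - 1) / genReal e (radius n * s) := by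
    have hcomp := intervalIntegral.mul_integral_comp_mul_left (a := 0) (b := 1)
      (f := fun x => x ^ (j - 1) / genReal e x) (radius n)
    rw [mul_zero, mul_one] at hcomp
    simp only [mul_pow, mul_div_assoc, intervalIntegral.integral_const_mul] at hcomp
    rw [abelWeight, ← hcomp, ← mul_assoc, mul_pow_sub_one (by lia)]
  have hint : ∫ s in (0 : ℝ)..1, s ^ (j - 1) / genReal e (radius n * s) ≤
      2 ^ D * (1 + D.factorial) / (j * genReal e (radius n)) := by
    refine integral_pow_div_le ⟨zero_le_one, le_rfl⟩ (genReal_pos e _) (hn.trans hnj)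
      ((continuousOn_genReal (.of_mem_Icc he)).comp (by fun_prop) fun s hs =>
        ⟨mul_nonneg hr0.le hs.1, (mul_le_of_le_one_right hr0.le hs.2).trans_lt hr1⟩)
      (fun s _ => genReal_pos e _) fun s hs => ?_
    have hy : 0 ≤ 1 - s := sub_nonneg.2 hs.2
    refine (genReal_radius_le_mul_genReal_mul he hn hs).trans ?_
    have := genReal_pos e (radius n * s)
    gcongr
  calc abelWeight e n j ≤
        radius n ^ j * (2 ^ D * (1 + D.factorial) / (j * genReal e (radius n))) := by
        rw [hsubst]
        gcongr
    _ = _ := by ring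

end AbelWeight

/-- The weight `∫_0^1 x ^ (j - 1) [z ^ (n - j)] (p(z) / p(x z)) dx` with which `S(g; j)`
contributes to the sum `∑_{k=1}^{n} a_k p_{n-k}`. -/
noncomputable def meanWeight (e : ℕ → ℝ) (n j : ℕ) : ℝ :=
  ∫ x in (0 : ℝ)..1, x ^ (j - 1) * genCoeff (quotExp x e) (n - j)

/-- The size `(j / n) ^ θ / (j p(r_j))` of the coefficient of `S(g; j)`, `j ≤ n`, in the error
term. -/
noncomputable def errorScale (θ : ℝ) (e : ℕ → ℝ) (n j : ℕ) : ℝ :=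
  ((j : ℝ) / n) ^ θ / (j * genReal e (radius j))

section ErrorScale

variable {e : ℕ → ℝ} {D n j : ℕ} {θ : ℝ}

lemma errorScale_nonneg (θ : ℝ) (e : ℕ → ℝ) (n j : ℕ) : 0 ≤ errorScale θ e n j := by
  have := genReal_pos e (radius j)
  unfold errorScale
  positivity

lemma div_le_errorScale (hθ : θ ≤ 1) (hj : 1 ≤ j) (hjn : j ≤ n) :
    (j : ℝ) / n / (j * genReal e (radius j)) ≤ errorScale θ e n j := by
  have hn0 : (0 : ℝ) < n := by exact_mod_cast hj.trans hjn
  have hj0 : (0 : ℝ) < j := by exact_mod_cast hj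
  have := genReal_pos e (radius j)
  unfold errorScale
  gcongr
  have hrpow := Real.rpow_le_rpow_of_exponent_ge (div_pos hj0 hn0)
    (div_le_one_of_le₀ (by exact_mod_cast hjn) hn0.le) hθ
  rwa [Real.rpow_one] at hrpow

lemma one_div_le_errorScale {D : ℝ} (hθ : θ ≤ 1) (he : ∀ k, e (k + 1) ∈ Set.Icc 0 D) (hj : 1 ≤ j)
    (hjn : j ≤ n) : 1 / (n * genReal e (radius n)) ≤ errorScale θ e n j := by
  have hn0 : (0 : ℝ) < n := by exact_mod_cast hj.trans hjn
  have : (0 : ℝ) < j := by exact_mod_cast hj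
  have := genReal_pos e (radius j)
  calc 1 / (n * genReal e (radius n)) ≤ 1 / (n * genReal e (radius j)) := by
        gcongr
        exact genReal_mono he (radius_pos j).le (radius_mono hj hjn) (radius_lt_one (hj.trans hjn))
    _ = (j : ℝ) / n / (j * genReal e (radius j)) := by field_simp
    _ ≤ _ := div_le_errorScale hθ hj hjn

lemma errorScale_le {D : ℝ} (he : ∀ k, e (k + 1) ∈ Set.Ioc 0 D) (hj : 1 ≤ j) (n : ℕ) :
    errorScale θ e n j ≤
      3 * D * (1 / (n : ℝ) ^ θ * (1 / genCoeff e j * (j : ℝ) ^ (θ - 2))) := by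
  have he0 : ∀ k, e (k + 1) ∈ Set.Icc 0 D := fun k => Set.Ioc_subset_Icc_self (he k)
  have hj0 : (0 : ℝ) < j := by exact_mod_cast hj
  have := genCoeff_pos (.of_mem_Icc he0) (fun k => (he k).1) j
  have := genReal_pos e (radius j)
  have hinv : 1 / genReal e (radius j) ≤ 3 * D / (j * genCoeff e j) := by
    rw [div_le_div_iff₀ (by positivity) (by positivity)]
    linarith [mul_genCoeff_le he0 hj le_rfl]
  rw [errorScale, Real.div_rpow hj0.le n.cast_nonneg, Real.rpow_sub hj0, Real.rpow_two]
  calc (j : ℝ) ^ θ / (n : ℝ) ^ θ / (j * genReal e (radius j))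
      = (j : ℝ) ^ θ / (n : ℝ) ^ θ / j * (1 / genReal e (radius j)) := by field_simp
    _ ≤ (j : ℝ) ^ θ / (n : ℝ) ^ θ / j * (3 * D / (j * genCoeff e j)) := by gcongr
    _ = _ := by field_simp

end ErrorScale

section MeanWeight

variable {e : ℕ → ℝ} {D n j : ℕ} {θ : ℝ}

lemma continuousOn_genCoeff_quotExp (he : BddExponent e) (N : ℕ) :
    ContinuousOn (fun x => genCoeff (quotExp x e) N) (Set.Icc 0 1) :=
  (continuous_finsetSum (range (N + 1)) fun m _ => by fun_prop :
    Continuous fun x : ℝ => ∑ m ∈ range (N + 1), x ^ m * genCoeff (-e) m * genCoeff e (N - m))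
    |>.continuousOn.congr fun _ hx => genCoeff_quotExp_eq_sum he hx N

lemma intervalIntegrable_pow_mul_genCoeff_quotExp (he : BddExponent e) (n j : ℕ) {a b : ℝ}
    (ha : 0 ≤ a) (hab : a ≤ b) (hb : b ≤ 1) :
    IntervalIntegrable (fun x => x ^ (j - 1) * genCoeff (quotExp x e) (n - j))
      MeasureTheory.volume a b := by
  refine ContinuousOn.intervalIntegrable ?_
  rw [Set.uIcc_of_le hab]
  exact ContinuousOn.mul (by fun_prop)
    ((continuousOn_genCoeff_quotExp he _).mono (Set.Icc_subset_Icc ha hb))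

lemma abs_pow_mul_genCoeff_quotExp_le (he : ∀ k, e (k + 1) ∈ Set.Icc (0 : ℝ) D) (hjn : j < n)
    {x c : ℝ} (hx : x ∈ Set.Icc 0 1) (hc : ((n - j : ℕ) : ℝ) ≤ c) :
    |x ^ (j - 1) * genCoeff (quotExp x e) (n - j)| ≤
      3 * D * (x ^ (j - 1) * ((1 - x) * (1 + c * (1 - x)) ^ D)) := by
  have hx0 : 0 ≤ x := hx.1
  have hy : 0 ≤ 1 - x := sub_nonneg.2 hx.2
  rw [abs_of_nonneg (mul_nonneg (pow_nonneg hx0 _)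
    (genCoeff_nonneg (quotExp_mem_Icc he hx) (n - j)))]
  calc x ^ (j - 1) * genCoeff (quotExp x e) (n - j)
      ≤ x ^ (j - 1) * (3 * D * (1 - x) * (1 + (n - j : ℕ) * (1 - x)) ^ D) := by
        gcongr
        simpa only [Real.rpow_natCast] using genCoeff_quotExp_le he hx (by lia)
    _ ≤ x ^ (j - 1) * (3 * D * (1 - x) * (1 + c * (1 - x)) ^ D) := by gcongr
    _ = _ := by ring

lemma abs_integral_radius_one_le (he : ∀ k, e (k + 1) ∈ Set.Icc (0 : ℝ) D) (hjn : j < n) :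
    |∫ x in radius n..1, x ^ (j - 1) * genCoeff (quotExp x e) (n - j)| ≤
      3 * D * 2 ^ D / n ^ 2 := by
  have hn0 : (0 : ℝ) < n := by exact_mod_cast j.zero_le.trans_lt hjn
  have hr1 := (radius_lt_one (by lia : 1 ≤ n)).le
  have hbound : ∀ x ∈ Set.uIoc (radius n) 1,
      ‖x ^ (j - 1) * genCoeff (quotExp x e) (n - j)‖ ≤ 3 * D * 2 ^ D / n := by
    intro x hx
    rw [Set.uIoc_of_le hr1] at hx
    have hx0 : 0 ≤ x := (radius_pos n).le.trans hx.1.le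
    have hy : 0 ≤ 1 - x := sub_nonneg.2 hx.2
    have hyn : 1 - x ≤ 1 / n := by linarith [hx.1, one_sub_radius_le n]
    calc _ ≤ 3 * D * (x ^ (j - 1) * ((1 - x) * (1 + n * (1 - x)) ^ D)) :=
          abs_pow_mul_genCoeff_quotExp_le he hjn ⟨hx0, hx.2⟩ (by exact_mod_cast n.sub_le j)
      _ ≤ 3 * D * (1 * (1 / n * (1 + n * (1 / n)) ^ D)) := by
          gcongr
          exact pow_le_one₀ hx0 hx.2
      _ = _ := by rw [mul_one_div_cancel hn0.ne', one_add_one_eq_two]; ring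
  calc _ ≤ 3 * D * 2 ^ D / n * |1 - radius n| :=
        intervalIntegral.norm_integral_le_of_norm_le_const hbound
    _ ≤ 3 * D * 2 ^ D / n * (1 / n) := by
        rw [abs_of_nonneg (sub_nonneg.2 hr1)]
        gcongr
        exact one_sub_radius_le n
    _ = _ := by ring

lemma abs_meanWeight_le (he : ∀ k, e (k + 1) ∈ Set.Icc (0 : ℝ) D) (hj : 1 ≤ j) (hjn : j < n)
    (hnj : n ≤ 8 * j) :
    |meanWeight e n j| ≤
      3 * D * (2 ^ D * (1 + 8 ^ D * (1 + D).factorial)) * 64 / n ^ 2 := by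
  have hn0 : (0 : ℝ) < n := by exact_mod_cast j.zero_le.trans_lt hjn
  have : (0 : ℝ) < j := by exact_mod_cast hj
  have hbeta := integral_pow_mul_one_sub_pow_mul_one_add_pow_le D 1 (by norm_num : (0 : ℝ) ≤ 8) hj
  simp only [pow_one, Nat.factorial_one, Nat.cast_one] at hbeta
  calc |meanWeight e n j|
      ≤ ∫ x in (0 : ℝ)..1, 3 * D * (x ^ (j - 1) * ((1 - x) * (1 + 8 * j * (1 - x)) ^ D)) := by
        rw [meanWeight, ← Real.norm_eq_abs]
        refine intervalIntegral.norm_integral_le_of_norm_le zero_le_one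
          (.of_forall fun x hx => ?_) ?_
        · exact abs_pow_mul_genCoeff_quotExp_le he hjn ⟨hx.1.le, hx.2⟩
            (by exact_mod_cast (n.sub_le j).trans hnj)
        · exact Continuous.intervalIntegrable (by fun_prop) _ _
    _ = 3 * D * ∫ x in (0 : ℝ)..1, x ^ (j - 1) * ((1 - x) * (1 + 8 * j * (1 - x)) ^ D) :=
        intervalIntegral.integral_const_mul _ _
    _ ≤ 3 * D * (2 ^ D * (1 + 8 ^ D * (1 + D).factorial) / (j : ℝ) ^ (1 + 1)) := by gcongr
    _ = 3 * D * (2 ^ D * (1 + 8 ^ D * (1 + D).factorial)) * 64 / (8 * j) ^ 2 := by ring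
    _ ≤ _ := by
        gcongr
        exact_mod_cast hnj

end MeanWeight

section WeightComparison

variable {e : ℕ → ℝ} {D n j : ℕ} {θ : ℝ}

lemma abelWeight_le_errorScale (hθ : θ ≤ 1) (he : ∀ k, e (k + 1) ∈ Set.Icc (0 : ℝ) D)
    (hj : 1 ≤ j) (hjn : j ≤ n) (hnj : n ≤ 8 * j) :
    abelWeight e n j ≤ 3 * 2 ^ D * (2 ^ D * (1 + D.factorial)) * 8 * errorScale θ e n j := by
  have hn0 : (0 : ℝ) < n := by exact_mod_cast hj.trans hjn
  have := genReal_pos e (radius j)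
  have height : 1 ≤ 8 * ((j : ℝ) / n) := by
    rw [← mul_div_assoc, one_le_div hn0]
    exact_mod_cast hnj
  calc abelWeight e n j
      ≤ 3 * 2 ^ D * (2 ^ D * (1 + D.factorial)) / (j * genReal e (radius j)) :=
        abelWeight_le he (hj.trans hjn) hj
    _ ≤ 3 * 2 ^ D * (2 ^ D * (1 + D.factorial)) * (8 * ((j : ℝ) / n)) /
          (j * genReal e (radius j)) := by
        exact div_le_div_of_nonneg_right (le_mul_of_one_le_right (by positivity) height)
          (by positivity)
    _ = 3 * 2 ^ D * (2 ^ D * (1 + D.factorial)) * 8 *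
          ((j : ℝ) / n / (j * genReal e (radius j))) := by ring
    _ ≤ _ := by
        gcongr
        exact div_le_errorScale hθ hj hjn

lemma exists_abs_genCoeff_quotExp_div_sub_le (D : ℕ) (hθ : θ ∈ Set.Ioc 0 1) :
    ∃ C > 0, ∀ e : ℕ → ℝ, (∀ k, e (k + 1) ∈ Set.Icc θ D) → ∀ n j : ℕ, 1 ≤ j → 8 * j ≤ n →
    ∀ x ∈ Set.Icc 0 (radius n),
    |genCoeff (quotExp x e) (n - j) / genCoeff e n - 1 / genReal e x| ≤
      C * (((j : ℝ) / n) ^ θ / genReal e (radius j)) * (1 + j * (1 - x)) ^ D := by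
  obtain ⟨C, hC, hcoeff⟩ := exists_abs_genCoeff_sub_le D
  have hθ0 := hθ.1
  refine ⟨C * (2 * (2 * (D + 1)) ^ D / θ) * (3 * 2 ^ D), by positivity,
    fun e he n j hj hjn x hx => ?_⟩
  have hn : 1 ≤ n := by lia
  have hn0 : (0 : ℝ) < n := by exact_mod_cast hn
  have : (0 : ℝ) < j := by exact_mod_cast hj
  have hx1 : x < 1 := hx.2.trans_lt (radius_lt_one hn)
  have hy : 0 < 1 - x := sub_pos.2 hx1
  have hp := genCoeff_pos (.of_mem_Icc he) (fun k => hθ0.trans_le (he k).1) n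
  have hP := genReal_pos e x
  have hG := genReal_pos e (radius j)
  have hscale : (1 + j * (1 - x)) ^ θ / (n * (1 - x)) ^ θ =
      ((j : ℝ) / n) ^ θ * ((1 + j * (1 - x)) / (j * (1 - x))) ^ θ := by
    rw [← Real.mul_rpow (by positivity) (by positivity), ← Real.div_rpow (by positivity)
      (by positivity)]
    congr 1
    field_simp
  have hradius : genReal e (radius n) / n ≤ 2 * (2 * (D + 1)) ^ D / θ * genCoeff e n := by
    rw [div_le_iff₀ hn0]
    linarith [genReal_radius_le hθ0 he hn]
  have hrpow : ((1 + j * (1 - x)) / (j * (1 - x))) ^ θ ≤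
      3 * 2 ^ D * (1 + j * (1 - x)) ^ D * genReal e x / genReal e (radius j) := by
    rw [le_div_iff₀ hG, mul_comm]
    exact genReal_radius_mul_rpow_le ⟨hθ0.le, hθ.2⟩ he hj ⟨hx.1, hx1⟩
  calc _ = |genCoeff e n - genReal e x * genCoeff (quotExp x e) (n - j)| /
        (genCoeff e n * genReal e x) := by
        rw [div_sub_div _ _ hp.ne' hP.ne', abs_div, abs_of_pos (mul_pos hp hP), abs_sub_comm]
        ring_nf
    _ ≤ C * (2 * (2 * (D + 1)) ^ D / θ * genCoeff e n) * (((j : ℝ) / n) ^ θ *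
        (3 * 2 ^ D * (1 + j * (1 - x)) ^ D * genReal e x / genReal e (radius j))) /
        (genCoeff e n * genReal e x) := by
        refine div_le_div_of_nonneg_right
          ((hcoeff θ ⟨hθ0.le, hθ.2⟩ e he n j hn hjn x hx).trans ?_) (by positivity)
        rw [hscale]
        gcongr
    _ = _ := by field_simp

lemma exists_abs_integral_zero_radius_sub_le (D : ℕ) (hθ : θ ∈ Set.Ioc 0 1) :
    ∃ C > 0, ∀ e : ℕ → ℝ, (∀ k, e (k + 1) ∈ Set.Icc θ D) → ∀ n j : ℕ, 1 ≤ j → 8 * j ≤ n →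
    |(∫ x in (0 : ℝ)..radius n, x ^ (j - 1) * genCoeff (quotExp x e) (n - j)) / genCoeff e n -
      abelWeight e n j| ≤ C * errorScale θ e n j := by
  obtain ⟨C, hC, hpoint⟩ := exists_abs_genCoeff_quotExp_div_sub_le D hθ
  refine ⟨C * (2 ^ D * (1 + D.factorial)), by positivity, fun e he n j hj hjn => ?_⟩
  have hn : 1 ≤ n := by lia
  have hr0 := (radius_pos n).le
  have hr1 := (radius_lt_one hn).le
  have := genReal_pos e (radius j)
  rw [← intervalIntegral.integral_div, abelWeight, ← intervalIntegral.integral_sub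
    ((intervalIntegrable_pow_mul_genCoeff_quotExp (.of_mem_Icc he) n j le_rfl hr0 hr1).div_const _)
    (intervalIntegrable_pow_div_genReal (.of_mem_Icc he) hn j)]
  calc _ ≤ ∫ x in (0 : ℝ)..radius n, C * (((j : ℝ) / n) ^ θ / genReal e (radius j)) *
        (x ^ (j - 1) * (1 + j * (1 - x)) ^ D) := by
        rw [← Real.norm_eq_abs]
        refine intervalIntegral.norm_integral_le_of_norm_le hr0 (.of_forall fun x hx => ?_)
          ?_
        swap
        · exact Continuous.intervalIntegrable (by fun_prop) _ _
        have hxj := pow_nonneg hx.1.le (j - 1)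
        rw [mul_div_assoc, div_eq_mul_one_div (x ^ (j - 1)), ← mul_sub, norm_mul,
          Real.norm_of_nonneg hxj, mul_left_comm]
        exact mul_le_mul_of_nonneg_left (hpoint e he n j hj hjn x ⟨hx.1.le, hx.2⟩) hxj
    _ = C * (((j : ℝ) / n) ^ θ / genReal e (radius j)) *
        ∫ x in (0 : ℝ)..radius n, x ^ (j - 1) * (1 + j * (1 - x)) ^ D :=
        intervalIntegral.integral_const_mul _ _
    _ ≤ C * (((j : ℝ) / n) ^ θ / genReal e (radius j)) * (2 ^ D * (1 + D.factorial) / j) := by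
        gcongr
        exact integral_pow_mul_one_add_pow_le D ⟨hr0, hr1⟩ hj
    _ = _ := by rw [errorScale]; ring

lemma div_sq_div_genCoeff_le_errorScale (hθ : θ ∈ Set.Ioc 0 1)
    (he : ∀ k, e (k + 1) ∈ Set.Icc θ D) (hj : 1 ≤ j) (hjn : j ≤ n) {A : ℝ} (hA : 0 ≤ A) :
    A / n ^ 2 / genCoeff e n ≤ A * (2 * (2 * (D + 1)) ^ D / θ) * errorScale θ e n j := by
  have hn := hj.trans hjn
  have : (0 : ℝ) < n := by exact_mod_cast hn
  have hθ0 := hθ.1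
  have hp := genCoeff_pos (.of_mem_Icc he) (fun k => hθ0.trans_le (he k).1) n
  have hR := genReal_pos e (radius n)
  calc A / n ^ 2 / genCoeff e n = A / n * (1 / (n * genCoeff e n)) := by ring
    _ ≤ A / n * (2 * (2 * (D + 1)) ^ D / θ / genReal e (radius n)) := by
        refine mul_le_mul_of_nonneg_left ?_ (by positivity)
        rw [div_le_div_iff₀ (by positivity) hR, one_mul]
        exact genReal_radius_le hθ0 he hn
    _ = A * (2 * (2 * (D + 1)) ^ D / θ) * (1 / (n * genReal e (radius n))) := by ring
    _ ≤ _ := by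
        gcongr
        exact one_div_le_errorScale hθ.2 (fun k => ⟨hθ0.le.trans (he k).1, (he k).2⟩) hj hjn

lemma exists_abs_meanWeight_div_sub_le (D : ℕ) (hθ : θ ∈ Set.Ioc 0 1) :
    ∃ C > 0, ∀ e : ℕ → ℝ, (∀ k, e (k + 1) ∈ Set.Icc θ D) → ∀ n j : ℕ, 1 ≤ j → j < n →
    |meanWeight e n j / genCoeff e n - abelWeight e n j| ≤ C * errorScale θ e n j := by
  obtain ⟨C, hC, hzero⟩ := exists_abs_integral_zero_radius_sub_le D hθ
  have hθ0 := hθ.1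
  set K : ℝ := 2 * (2 * (D + 1)) ^ D / θ
  set V : ℝ := 3 * D * (2 ^ D * (1 + 8 ^ D * (1 + D).factorial)) * 64
  set W : ℝ := 3 * 2 ^ D * (2 ^ D * (1 + D.factorial)) * 8
  refine ⟨(C + 3 * D * 2 ^ D * K) + (V * K + W), by positivity, fun e he n j hj hjn => ?_⟩
  have he0 : ∀ k, e (k + 1) ∈ Set.Icc (0 : ℝ) D := fun k => ⟨hθ0.le.trans (he k).1, (he k).2⟩
  have hp := genCoeff_pos (.of_mem_Icc he) (fun k => hθ0.trans_le (he k).1) n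
  have hscale : 0 ≤ errorScale θ e n j := errorScale_nonneg _ _ _ _
  rw [add_mul]
  rcases le_total (8 * j) n with h8 | h8
  · refine le_add_of_le_of_nonneg ?_ (by positivity)
    have hr0 := (radius_pos n).le
    have hr1 := (radius_lt_one (by lia : 1 ≤ n)).le
    rw [meanWeight, ← intervalIntegral.integral_add_adjacent_intervals
      (intervalIntegrable_pow_mul_genCoeff_quotExp (.of_mem_Icc he) n j le_rfl hr0 hr1)
      (intervalIntegrable_pow_mul_genCoeff_quotExp (.of_mem_Icc he) n j hr0 hr1 le_rfl),
      add_div, add_sub_right_comm, add_mul]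
    refine (abs_add_le _ _).trans (add_le_add (hzero e he n j hj h8) ?_)
    rw [abs_div, abs_of_pos hp]
    refine le_trans ?_ (div_sq_div_genCoeff_le_errorScale hθ he hj hjn.le (by positivity))
    gcongr
    exact abs_integral_radius_one_le he0 hjn
  · refine le_add_of_nonneg_of_le (by positivity) ?_
    rw [add_mul]
    refine (abs_sub _ _).trans (add_le_add ?_ ?_)
    · rw [abs_div, abs_of_pos hp]
      refine le_trans ?_ (div_sq_div_genCoeff_le_errorScale hθ he hj hjn.le (by positivity))
      gcongr
      exact abs_meanWeight_le he0 hj hjn h8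
    · rw [abs_of_nonneg (abelWeight_nonneg e n j)]
      exact abelWeight_le_errorScale hθ.2 he0 hj hjn.le h8

end WeightComparison

section Inversion

variable {e : ℕ → ℝ} {n j : ℕ}

lemma S_zero (p : ℕ → ℝ) (a : ℕ → ℂ) : S p a 0 = 0 := by simp [S]

lemma genCoeff_zero_left (n : ℕ) : genCoeff 0 n = if n = 0 then 1 else 0 := by
  cases n with
  | zero => exact genCoeff_zero 0
  | succ n =>
    have hrec := genCoeff_succ (e := 0) (.const 0) n
    simp only [Pi.zero_apply, zero_mul, sum_const_zero] at hrec
    simpa using (mul_eq_zero.1 hrec).resolve_left (by positivity)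

lemma mk_genCoeff_mul_mk_genCoeff_neg (he : BddExponent e) :
    PowerSeries.mk (fun k => (genCoeff e k : ℂ)) *
      PowerSeries.mk (fun k => (genCoeff (-e) k : ℂ)) = 1 := by
  ext n
  have hconv := genCoeff_add he he.neg n
  rw [add_neg_cancel, genCoeff_zero_left] at hconv
  simp only [PowerSeries.coeff_mul, Nat.sum_antidiagonal_eq_sum_range_succ_mk,
    PowerSeries.coeff_one, PowerSeries.coeff_mk]
  simpa [apply_ite Complex.ofReal] using congrArg Complex.ofReal hconv.symm

lemma mk_S (e : ℕ → ℝ) (a : ℕ → ℂ) :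
    PowerSeries.mk (S (genCoeff e) a) =
      PowerSeries.mk (fun k => a k * k) * PowerSeries.mk (fun k => (genCoeff e k : ℂ)) := by
  ext n
  simp only [PowerSeries.coeff_mul, Nat.sum_antidiagonal_eq_sum_range_succ_mk,
    PowerSeries.coeff_mk, S]

lemma sum_S_mul_genCoeff_neg (he : BddExponent e) (a : ℕ → ℂ) (k : ℕ) :
    ∑ j ∈ range (k + 1), S (genCoeff e) a j * (genCoeff (-e) (k - j) : ℂ) = a k * k := by
  have hprod : PowerSeries.mk (S (genCoeff e) a) * PowerSeries.mk (fun k => (genCoeff (-e) k : ℂ)) =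
      PowerSeries.mk fun k => a k * k := by
    rw [mk_S, mul_assoc, mk_genCoeff_mul_mk_genCoeff_neg he, mul_one]
  simpa only [PowerSeries.coeff_mul, Nat.sum_antidiagonal_eq_sum_range_succ_mk,
    PowerSeries.coeff_mk] using congrArg (PowerSeries.coeff k) hprod

lemma eq_sum_S_div (he : BddExponent e) (a : ℕ → ℂ) (k : ℕ) :
    a k = (if k = 0 then a 0 else 0) +
      ∑ j ∈ range (k + 1), S (genCoeff e) a j * (genCoeff (-e) (k - j) : ℂ) / k := by
  rw [← sum_div, sum_S_mul_genCoeff_neg he]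
  rcases eq_or_ne k 0 with rfl | hk
  · simp
  · rw [if_neg hk, zero_add, mul_div_cancel_right₀ _ (Nat.cast_ne_zero.2 hk)]

lemma meanWeight_eq_sum (he : BddExponent e) (hj : 1 ≤ j) (n : ℕ) :
    meanWeight e n j = ∑ m ∈ range (n - j + 1),
      genCoeff (-e) m * genCoeff e (n - j - m) / ((j + m : ℕ) : ℝ) := by
  have hexpand : meanWeight e n j = ∫ x in (0 : ℝ)..1, ∑ m ∈ range (n - j + 1),
      genCoeff (-e) m * genCoeff e (n - j - m) * x ^ (j + m - 1) := by
    refine intervalIntegral.integral_congr fun x hx => ?_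
    rw [Set.uIcc_of_le zero_le_one] at hx
    simp only [genCoeff_quotExp_eq_sum he hx, mul_sum, Nat.sub_add_comm hj, pow_add]
    exact sum_congr rfl fun m _ => by ring
  rw [hexpand, intervalIntegral.integral_finsetSum fun m _ =>
    Continuous.intervalIntegrable (by fun_prop) _ _]
  refine sum_congr rfl fun m _ => ?_
  obtain ⟨i, rfl⟩ := Nat.exists_eq_add_of_le' hj
  simp [Nat.add_right_comm i 1 m, integral_pow, div_eq_mul_inv]

lemma meanWeight_self (e : ℕ → ℝ) (hn : 1 ≤ n) : meanWeight e n n = 1 / n := by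
  obtain ⟨m, rfl⟩ := Nat.exists_eq_add_of_le' hn
  simp [meanWeight, genCoeff_zero, integral_pow]

lemma sum_mul_genCoeff_eq (he : BddExponent e) (a : ℕ → ℂ) (n : ℕ) :
    ∑ k ∈ range (n + 1), a k * (genCoeff e (n - k) : ℂ) =
      a 0 * genCoeff e n + ∑ j ∈ Icc 1 n, S (genCoeff e) a j * (meanWeight e n j : ℂ) := by
  have hterm : ∀ k, a k * (genCoeff e (n - k) : ℂ) =
      (if k = 0 then a 0 * (genCoeff e n : ℂ) else 0) + ∑ j ∈ range (k + 1),
        S (genCoeff e) a j * (genCoeff (-e) (k - j) : ℂ) / k * (genCoeff e (n - k) : ℂ) := by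
    intro k
    conv_lhs => rw [eq_sum_S_div he a k]
    rw [add_mul, sum_mul]
    rcases eq_or_ne k 0 with rfl | hk
    · simp
    · simp [hk]
  rw [sum_congr rfl fun k _ => hterm k, sum_add_distrib, sum_ite_eq',
    if_pos (mem_range.2 n.succ_pos), sum_comm' (t' := range (n + 1))
      (s' := fun j => Ico j (n + 1)) (by grind), range_eq_Ico, sum_eq_sum_Ico_succ_bot n.succ_pos]
  simp only [S_zero, zero_mul, zero_div, sum_const_zero, zero_add, Ico_add_one_right_eq_Icc]
  congr 1
  refine sum_congr rfl fun j hj => ?_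
  obtain ⟨hj1, hjn⟩ := mem_Icc.1 hj
  rw [meanWeight_eq_sum he hj1, ← Ico_add_one_right_eq_Icc, sum_Ico_eq_sum_range,
    Complex.ofReal_sum, mul_sum, Nat.sub_add_comm hjn]
  refine sum_congr rfl fun m _ => ?_
  rw [Nat.add_sub_cancel_left, Nat.sub_sub]
  push_cast
  ring

lemma hasSum_abelWeight (he : BddExponent e) (hn : 1 ≤ n) (hj : 1 ≤ j) :
    HasSum (fun m : ℕ => genCoeff (-e) m * radius n ^ (j + m) / ((j + m : ℕ) : ℝ))
      (abelWeight e n j) := by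
  have hr0 := (radius_pos n).le
  have hr1 := radius_lt_one hn
  have hpoint : ∀ x ∈ Set.uIoc 0 (radius n), HasSum
      (fun m : ℕ => genCoeff (-e) m * x ^ (j - 1 + m)) (x ^ (j - 1) / genReal e x) := by
    intro x hx
    rw [Set.uIoc_of_le hr0] at hx
    rw [div_eq_mul_inv, ← genReal_neg]
    exact ((hasSum_genReal he.neg hx.1.le (hx.2.trans_lt hr1)).mul_left (x ^ (j - 1))).congr_fun
      fun m => by rw [pow_add, mul_left_comm]
  have hdom : ∀ (m : ℕ), ∀ x ∈ Set.uIoc 0 (radius n),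
      ‖genCoeff (-e) m * x ^ (j - 1 + m)‖ ≤ |genCoeff (-e) m * radius n ^ m| := by
    intro m x hx
    rw [Set.uIoc_of_le hr0] at hx
    have hx0 := hx.1.le
    rw [Real.norm_eq_abs, abs_mul, abs_mul, abs_of_nonneg (pow_nonneg hx0 _),
      abs_of_nonneg (pow_nonneg hr0 _), pow_add]
    gcongr
    calc x ^ (j - 1) * x ^ m ≤ 1 * radius n ^ m := by
          gcongr
          exacts [pow_le_one₀ hx0 (hx.2.trans hr1.le), hx.2]
      _ = _ := one_mul _
  refine (intervalIntegral.hasSum_integral_of_dominated_convergence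
    (fun m _ => |genCoeff (-e) m * radius n ^ m|)
    (fun m => (by fun_prop : Continuous fun x : ℝ => genCoeff (-e) m * x ^ (j - 1 + m))
      |>.aestronglyMeasurable)
    (fun m => .of_forall (hdom m))
    (.of_forall fun _ _ => (hasSum_genReal he.neg hr0 hr1).summable.abs)
    intervalIntegrable_const (.of_forall hpoint)).congr_fun fun m => ?_
  obtain ⟨i, rfl⟩ := Nat.exists_eq_add_of_le' hj
  simp [Nat.add_right_comm i 1 m, integral_pow, mul_div_assoc]

end Inversion

section SummableS

variable {e : ℕ → ℝ} {a : ℕ → ℂ} {g : ℂ → ℂ} {r : ℝ}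

lemma summable_norm_mul_coeff (hg : ∀ z : ℂ, ‖z‖ < 1 → HasSum (fun k : ℕ => a k * z ^ k) (g z))
    (hr0 : 0 ≤ r) (hr : r < 1) : Summable fun k : ℕ => ‖a k * k * (r : ℂ) ^ k‖ := by
  obtain ⟨s, hrs, hs1⟩ := exists_between hr
  have hs0 : 0 < s := hr0.trans_lt hrs
  obtain ⟨B, hB⟩ := (hg (s : ℂ) (by simpa [abs_of_pos hs0] using hs1)).summable
    |>.tendsto_atTop_zero.norm.bddAbove_range
  have hgeom : Summable fun k : ℕ => (k : ℝ) ^ 1 * (r / s) ^ k :=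
    summable_pow_mul_geometric_of_norm_lt_one 1 (by
      rw [Real.norm_of_nonneg (by positivity)]
      exact (div_lt_one hs0).2 hrs)
  refine .of_nonneg_of_le (fun _ => norm_nonneg _) (fun k => ?_) (hgeom.mul_left B)
  calc ‖a k * k * (r : ℂ) ^ k‖ = ‖a k * (s : ℂ) ^ k‖ * ((k : ℝ) ^ 1 * (r / s) ^ k) := by
        simp only [norm_mul, norm_pow, Complex.norm_natCast, Complex.norm_real, Real.norm_eq_abs,
          abs_of_nonneg hr0, abs_of_pos hs0, div_pow]
        field_simp
    _ ≤ B * ((k : ℝ) ^ 1 * (r / s) ^ k) := by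
        gcongr
        exact hB ⟨k, rfl⟩

lemma summable_norm_S_mul_pow (he : BddExponent e)
    (hg : ∀ z : ℂ, ‖z‖ < 1 → HasSum (fun k : ℕ => a k * z ^ k) (g z)) (hr0 : 0 ≤ r)
    (hr : r < 1) : Summable fun j : ℕ => ‖S (genCoeff e) a j‖ * r ^ j := by
  have hp : Summable fun k : ℕ => ‖(genCoeff e k : ℂ) * (r : ℂ) ^ k‖ :=
    (hasSum_genCoeff he (by simpa [abs_of_nonneg hr0] using hr)).summable.norm
  refine (summable_norm_sum_mul_range_of_summable_norm
    (summable_norm_mul_coeff hg hr0 hr) hp).congr fun j => ?_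
  calc _ = ‖S (genCoeff e) a j * (r : ℂ) ^ j‖ := by
        rw [S, sum_mul]
        refine congrArg norm (sum_congr rfl fun k hk => ?_)
        rw [← pow_mul_pow_sub (r : ℂ) (mem_range_succ_iff.1 hk)]
        ring
    _ = _ := by rw [norm_mul, norm_pow, Complex.norm_real, Real.norm_of_nonneg hr0]

lemma summable_norm_S_div_mul_pow (he : BddExponent e)
    (hg : ∀ z : ℂ, ‖z‖ < 1 → HasSum (fun k : ℕ => a k * z ^ k) (g z)) (hr0 : 0 ≤ r)
    (hr : r < 1) : Summable fun j : ℕ => ‖S (genCoeff e) a j‖ / j * r ^ j := by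
  refine .of_nonneg_of_le (fun j => by positivity) (fun j => ?_)
    (summable_norm_S_mul_pow he hg hr0 hr)
  gcongr
  rcases j.eq_zero_or_pos with rfl | hj
  · simp
  · exact div_le_self (norm_nonneg _) (by exact_mod_cast hj)

end SummableS

section AbelSum

variable {e : ℕ → ℝ} {a : ℕ → ℂ} {g : ℂ → ℂ} {n : ℕ}

/-- The term of index `(j, m)` in the double series obtained by expanding `1 / p` in
`∑_j S(g; j) ∫_0^{r_n} x ^ (j - 1) / p(x) dx`. -/
noncomputable def abelTerm (e : ℕ → ℝ) (a : ℕ → ℂ) (n : ℕ) (x : ℕ × ℕ) : ℂ :=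
  S (genCoeff e) a x.1 *
    ((genCoeff (-e) x.2 * radius n ^ (x.1 + x.2) / ((x.1 + x.2 : ℕ) : ℝ) : ℝ) : ℂ)

lemma summable_abelTerm (he : BddExponent e)
    (hg : ∀ z : ℂ, ‖z‖ < 1 → HasSum (fun k : ℕ => a k * z ^ k) (g z)) (hn : 1 ≤ n) :
    Summable (abelTerm e a n) := by
  have hr0 := (radius_pos n).le
  have hr1 := radius_lt_one hn
  refine .of_norm_bounded ((summable_norm_S_mul_pow he hg hr0 hr1).mul_of_nonneg
    (hasSum_genReal he.neg hr0 hr1).summable.abs (fun j => by positivity) fun m => abs_nonneg _)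
    fun x => ?_
  rw [abelTerm, norm_mul, Complex.norm_real, Real.norm_eq_abs, mul_assoc]
  gcongr
  rw [abs_div, Nat.abs_cast, pow_add, mul_left_comm, abs_mul, abs_of_nonneg (pow_nonneg hr0 x.1)]
  rcases (x.1 + x.2).eq_zero_or_pos with hx | hx
  · rw [hx, Nat.cast_zero, div_zero]
    positivity
  · exact div_le_self (by positivity) (by exact_mod_cast hx)

lemma hasSum_abelTerm_right (he : BddExponent e) (a : ℕ → ℂ) (hn : 1 ≤ n) (j : ℕ) :
    HasSum (fun m => abelTerm e a n (j, m)) (S (genCoeff e) a j * (abelWeight e n j : ℂ)) := by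
  rcases j.eq_zero_or_pos with rfl | hj
  · simpa only [abelTerm, S_zero, zero_mul] using hasSum_zero
  · exact (Complex.hasSum_ofReal.2 (hasSum_abelWeight he hn hj)).mul_left (S (genCoeff e) a j)

lemma sum_antidiagonal_abelTerm (he : BddExponent e) (a : ℕ → ℂ) (n k : ℕ) :
    ∑ x ∈ antidiagonal k, abelTerm e a n x =
      a k * (radius n : ℂ) ^ k - if k = 0 then a 0 else 0 := by
  have hsplit : a k * (radius n : ℂ) ^ k - (if k = 0 then a 0 else 0) =
      (a k - if k = 0 then a 0 else 0) * (radius n : ℂ) ^ k := by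
    rcases eq_or_ne k 0 with rfl | hk
    · simp
    · simp [hk]
  rw [hsplit, sub_eq_of_eq_add' (eq_sum_S_div he a k), sum_mul,
    Nat.sum_antidiagonal_eq_sum_range_succ_mk]
  refine sum_congr rfl fun j hj => ?_
  rw [abelTerm, Nat.add_sub_cancel' (mem_range_succ_iff.1 hj)]
  push_cast
  ring

lemma hasSum_S_mul_abelWeight (he : BddExponent e)
    (hg : ∀ z : ℂ, ‖z‖ < 1 → HasSum (fun k : ℕ => a k * z ^ k) (g z)) (hn : 1 ≤ n) :
    HasSum (fun j : ℕ => S (genCoeff e) a j * (abelWeight e n j : ℂ))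
      (g (radius n : ℂ) - a 0) := by
  have hsum := (summable_abelTerm he hg hn).hasSum
  have hdiag : HasSum (fun k : ℕ => ∑ x ∈ antidiagonal k, abelTerm e a n x)
      (∑' x, abelTerm e a n x) :=
    (HasAntidiagonal.sigmaAntidiagonalEquivProd.hasSum_iff.2 hsum).sigma
      fun k => (antidiagonal k).hasSum (abelTerm e a n)
  have hgsum : HasSum (fun k : ℕ => ∑ x ∈ antidiagonal k, abelTerm e a n x)
      (g (radius n : ℂ) - a 0) := by
    simp only [sum_antidiagonal_abelTerm he]
    refine (hg _ ?_).sub (hasSum_ite_eq 0 (a 0))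
    simpa [abs_of_pos (radius_pos n)] using radius_lt_one hn
  rw [← hdiag.unique hgsum]
  exact hsum.prod_fiberwise (hasSum_abelTerm_right he a hn)

end AbelSum

/-- The coefficient of `S(g; j)`, `1 ≤ j ≤ n`, in the error
`(1 / p_n) ∑_{k ≤ n} a_k p_{n-k} - g(r_n) - S(g; n) / (n p_n)`. -/
noncomputable def errorWeight (e : ℕ → ℝ) (n j : ℕ) : ℝ :=
  meanWeight e n j / genCoeff e n - abelWeight e n j - if j = n then 1 / (n * genCoeff e n) else 0

section ErrorBound

variable {e : ℕ → ℝ} {a : ℕ → ℂ} {g : ℂ → ℂ} {D n : ℕ} {θ : ℝ}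

lemma mean_eq (he : BddExponent e) (hp : genCoeff e n ≠ 0) (a : ℕ → ℂ) :
    mean (genCoeff e) a n = a 0 +
      ∑ j ∈ Icc 1 n, S (genCoeff e) a j * ((meanWeight e n j / genCoeff e n : ℝ) : ℂ) := by
  rw [← Complex.ofReal_ne_zero] at hp
  rw [mean, sum_mul_genCoeff_eq he, mul_add, one_div_mul_eq_div, mul_div_cancel_right₀ _ hp,
    mul_sum]
  refine congrArg _ (sum_congr rfl fun j _ => ?_)
  push_cast
  ring

lemma sum_S_mul_abelWeight (he : BddExponent e)
    (hg : ∀ z : ℂ, ‖z‖ < 1 → HasSum (fun k : ℕ => a k * z ^ k) (g z)) (hn : 1 ≤ n) :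
    ∑ j ∈ Icc 1 n, S (genCoeff e) a j * (abelWeight e n j : ℂ) =
      g (radius n : ℂ) - a 0 - ∑' j : Set.Ioi n, S (genCoeff e) a j * (abelWeight e n j : ℂ) := by
  have hsum := hasSum_S_mul_abelWeight he hg hn
  have hcompl : ((range (n + 1) : Finset ℕ) : Set ℕ)ᶜ = Set.Ioi n := by ext; simp
  rw [← hsum.tsum_eq, ← hsum.summable.sum_add_tsum_compl (s := range (n + 1)), hcompl,
    add_sub_cancel_right, range_eq_Ico, sum_eq_sum_Ico_succ_bot n.succ_pos, S_zero, zero_mul,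
    zero_add, zero_add, Nat.succ_eq_add_one, Ico_add_one_right_eq_Icc]

lemma mean_sub_eq (he : BddExponent e) (hp : genCoeff e n ≠ 0)
    (hg : ∀ z : ℂ, ‖z‖ < 1 → HasSum (fun k : ℕ => a k * z ^ k) (g z)) (hn : 1 ≤ n) :
    mean (genCoeff e) a n - g (radius n : ℂ) -
        S (genCoeff e) a n / ((n : ℂ) * (genCoeff e n : ℂ)) =
      ∑ j ∈ Icc 1 n, S (genCoeff e) a j * (errorWeight e n j : ℂ) -
        ∑' j : Set.Ioi n, S (genCoeff e) a j * (abelWeight e n j : ℂ) := by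
  have hlast : ∑ j ∈ Icc 1 n, S (genCoeff e) a j *
      ((if j = n then 1 / (n * genCoeff e n) else 0 : ℝ) : ℂ) =
        S (genCoeff e) a n / ((n : ℂ) * (genCoeff e n : ℂ)) := by
    simp [apply_ite Complex.ofReal, hn, div_eq_mul_inv]
  simp only [errorWeight, Complex.ofReal_sub, mul_sub, sum_sub_distrib, hlast, mean_eq he hp,
    sum_S_mul_abelWeight he hg hn]
  ring

lemma exists_abs_errorWeight_le (D : ℕ) (hθ : θ ∈ Set.Ioc 0 1) :
    ∃ C > 0, ∀ e : ℕ → ℝ, (∀ k, e (k + 1) ∈ Set.Icc θ D) → ∀ n j : ℕ, 1 ≤ j → j ≤ n →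
    |errorWeight e n j| ≤ C * (1 / (n : ℝ) ^ θ * (1 / genCoeff e j * (j : ℝ) ^ (θ - 2))) := by
  obtain ⟨C, hC, hlt⟩ := exists_abs_meanWeight_div_sub_le D hθ
  set C' : ℝ := 3 * 2 ^ D * (2 ^ D * (1 + D.factorial)) * 8
  have hC' : 0 < C' := by positivity
  refine ⟨(C + C') * (3 * D + 1), by positivity, fun e he n j hj hjn => ?_⟩
  have he0 : ∀ k, e (k + 1) ∈ Set.Ioc 0 (D : ℝ) := fun k => ⟨hθ.1.trans_le (he k).1, (he k).2⟩
  have hscale := errorScale_nonneg θ e n j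
  have hbound : |errorWeight e n j| ≤ (C + C') * errorScale θ e n j := by
    rcases hjn.lt_or_eq with hjn | rfl
    · rw [errorWeight, if_neg hjn.ne, sub_zero]
      refine (hlt e he n j hj hjn).trans ?_
      gcongr
      exact le_add_of_nonneg_right hC'.le
    · rw [errorWeight, if_pos rfl, meanWeight_self e hj, div_div, sub_sub_cancel_left, abs_neg,
        abs_of_nonneg (abelWeight_nonneg e j j)]
      refine (abelWeight_le_errorScale hθ.2 (fun k => Set.Ioc_subset_Icc_self (he0 k)) hj le_rfl
        (by lia)).trans ?_
      gcongr
      exact le_add_of_nonneg_left hC.le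
  refine hbound.trans ?_
  rw [mul_assoc]
  gcongr
  refine (errorScale_le he0 hj n).trans (mul_le_mul_of_nonneg_right (by linarith) ?_)
  have := genCoeff_pos (.of_mem_Icc he) (fun k => (he0 k).1) j
  positivity

lemma exists_norm_sum_S_mul_errorWeight_le (D : ℕ) (hθ : θ ∈ Set.Ioc 0 1) :
    ∃ C > 0, ∀ e : ℕ → ℝ, (∀ k, e (k + 1) ∈ Set.Icc θ D) → ∀ (a : ℕ → ℂ) (n : ℕ),
    ‖∑ j ∈ Icc 1 n, S (genCoeff e) a j * (errorWeight e n j : ℂ)‖ ≤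
      C * (1 / (n : ℝ) ^ θ *
        ∑ j ∈ Icc 1 n, ‖S (genCoeff e) a j‖ / genCoeff e j * (j : ℝ) ^ (θ - 2)) := by
  obtain ⟨C, hC, hweight⟩ := exists_abs_errorWeight_le D hθ
  refine ⟨C, hC, fun e he a n => ?_⟩
  simp only [mul_sum]
  refine norm_sum_le_of_le _ fun j hj => ?_
  obtain ⟨hj1, hjn⟩ := mem_Icc.1 hj
  rw [norm_mul, Complex.norm_real, Real.norm_eq_abs]
  calc _ ≤ ‖S (genCoeff e) a j‖ *
        (C * (1 / (n : ℝ) ^ θ * (1 / genCoeff e j * (j : ℝ) ^ (θ - 2)))) := by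
        gcongr
        exact hweight e he n j hj1 hjn
    _ = _ := by ring

lemma norm_tsum_S_mul_abelWeight_le (he : ∀ k, e (k + 1) ∈ Set.Icc (0 : ℝ) D)
    (hg : ∀ z : ℂ, ‖z‖ < 1 → HasSum (fun k : ℕ => a k * z ^ k) (g z)) (hn : 1 ≤ n) :
    ‖∑' j : Set.Ioi n, S (genCoeff e) a j * (abelWeight e n j : ℂ)‖ ≤
      2 ^ D * (1 + D.factorial) * (1 / genReal e (radius n) *
        ∑' j : Set.Ioi n, ‖S (genCoeff e) a j‖ / (j : ℕ) * radius n ^ (j : ℕ)) := by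
  have hsum := (summable_norm_S_div_mul_pow (.of_mem_Icc he) hg (radius_pos n).le
    (radius_lt_one hn)).subtype (Set.Ioi n)
  rw [← tsum_mul_left, ← tsum_mul_left]
  refine tsum_of_norm_bounded ((hsum.mul_left _).mul_left _).hasSum fun j => ?_
  rw [norm_mul, Complex.norm_real, Real.norm_of_nonneg (abelWeight_nonneg e n j)]
  calc _ ≤ ‖S (genCoeff e) a j‖ * (2 ^ D * (1 + D.factorial) *
        (radius n ^ (j : ℕ) / ((j : ℕ) * genReal e (radius n)))) := by
        gcongr
        exact abelWeight_le_of_le he hn j.2.le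
    _ = _ := by simp only [Function.comp_apply]; ring

lemma exists_norm_mean_sub_le (D : ℕ) (hθ : θ ∈ Set.Ioc 0 1) :
    ∃ C > 0, ∀ e : ℕ → ℝ, (∀ k, e (k + 1) ∈ Set.Icc θ D) → ∀ (a : ℕ → ℂ) (g : ℂ → ℂ),
    (∀ z : ℂ, ‖z‖ < 1 → HasSum (fun k : ℕ => a k * z ^ k) (g z)) → ∀ n : ℕ, 1 ≤ n →
    ‖mean (genCoeff e) a n - g (radius n : ℂ) -
        S (genCoeff e) a n / ((n : ℂ) * (genCoeff e n : ℂ))‖ ≤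
      C * (1 / (n : ℝ) ^ θ *
          ∑ j ∈ Icc 1 n, ‖S (genCoeff e) a j‖ / genCoeff e j * (j : ℝ) ^ (θ - 2) +
        1 / genReal e (radius n) *
          ∑' j : Set.Ioi n, ‖S (genCoeff e) a j‖ / (j : ℕ) * radius n ^ (j : ℕ)) := by
  obtain ⟨C, hC, hhead⟩ := exists_norm_sum_S_mul_errorWeight_le D hθ
  refine ⟨C + 2 ^ D * (1 + D.factorial), by positivity, fun e he a g hg n hn => ?_⟩
  have hpos := genCoeff_pos (.of_mem_Icc he) fun k => hθ.1.trans_le (he k).1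
  have := genReal_pos e (radius n)
  have := radius_pos n
  rw [mean_sub_eq (.of_mem_Icc he) (hpos n).ne' hg hn, mul_add]
  refine (norm_sub_le _ _).trans (add_le_add ((hhead e he a n).trans ?_)
    ((norm_tsum_S_mul_abelWeight_le (fun k => ⟨hθ.1.le.trans (he k).1, (he k).2⟩) hg hn).trans ?_))
  · gcongr
    · exact mul_nonneg (by positivity) (sum_nonneg fun j _ => mul_nonneg
        (div_nonneg (norm_nonneg _) (hpos j).le) (by positivity))
    · exact le_add_of_nonneg_right (by positivity)
  · gcongr
    exact le_add_of_nonneg_left hC.le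

end ErrorBound

end Voronoi

open Voronoi

theorem theorem1 (dm dp : ℝ) (hdm : 0 < dm) :
    ∃ c : ℝ, 0 < c ∧
      ∀ d : ℕ → ℝ, (∀ k : ℕ, 1 ≤ k → dm ≤ d k ∧ d k ≤ dp) →
        (∀ j : ℕ, 0 < Voronoi.genCoeff d j) ∧
        (∀ z : ℂ, ‖z‖ < 1 →
          HasSum (fun j : ℕ => (Voronoi.genCoeff d j : ℂ) * z ^ j) (Voronoi.genFun d z)) ∧
        ∀ (a : ℕ → ℂ) (g : ℂ → ℂ),
          (∀ z : ℂ, ‖z‖ < 1 → HasSum (fun k : ℕ => a k * z ^ k) (g z)) →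
          ∀ n : ℕ, 1 ≤ n →
            Summable (fun j : Set.Ioi n =>
              ‖Voronoi.S (Voronoi.genCoeff d) a (j : ℕ)‖ / ((j : ℕ) : ℝ) *
                Real.exp (-((j : ℕ) : ℝ) / (n : ℝ))) ∧
            ‖Voronoi.mean (Voronoi.genCoeff d) a n - g (Real.exp (-1 / (n : ℝ)) : ℂ) -
                Voronoi.S (Voronoi.genCoeff d) a n /
                  ((n : ℂ) * (Voronoi.genCoeff d n : ℂ))‖ ≤
              c * (1 / (n : ℝ) ^ (min dm 1) *
                    ∑ j ∈ Finset.Icc 1 n,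
                      ‖Voronoi.S (Voronoi.genCoeff d) a j‖ / Voronoi.genCoeff d j *
                        (j : ℝ) ^ (min dm 1 - 2) +
                  1 / (Voronoi.genFun d (Real.exp (-1 / (n : ℝ)) : ℂ)).re *
                    ∑' j : Set.Ioi n,
                      ‖Voronoi.S (Voronoi.genCoeff d) a (j : ℕ)‖ / ((j : ℕ) : ℝ) *
                        Real.exp (-((j : ℕ) : ℝ) / (n : ℝ))) := by
  obtain ⟨C, hC, hbound⟩ := exists_norm_mean_sub_le ⌈dp⌉₊
    (⟨lt_min hdm one_pos, min_le_right dm 1⟩ : min dm 1 ∈ Set.Ioc 0 1)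
  refine ⟨C, hC, fun d hd => ?_⟩
  have hmem : ∀ k, d (k + 1) ∈ Set.Icc dm ⌈dp⌉₊ := fun k =>
    ⟨(hd (k + 1) k.succ_pos).1, (hd (k + 1) k.succ_pos).2.trans (Nat.le_ceil dp)⟩
  have hbdd := BddExponent.of_mem_Icc hmem
  refine ⟨genCoeff_pos hbdd fun k => hdm.trans_le (hmem k).1,
    fun z hz => hasSum_genCoeff hbdd hz, fun a g hg n hn => ?_⟩
  simp only [← radius_pow]
  rw [← radius, genFun_ofReal, Complex.ofReal_re]
  exact ⟨(summable_norm_S_div_mul_pow hbdd hg (radius_pos n).le (radius_lt_one hn)).subtype _,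
    hbound d (fun k => Set.Icc_subset_Icc_left (min_le_left _ _) (hmem k)) a g hg n hn⟩
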